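/- **Lemma (Hölder continuity of the convective function).** Let $d\in\{2,3\}$, let $\Omega\subset\mathbb R^d$ be a bounded open set, and let $r,s\in(1,\infty)$. For $m\in[1,\infty]$ let $m'\in[1,\infty]$ be the conjugate exponent ($\frac1m+\frac1{m'}=1$), let $m^*=\frac{dm}{d-m}$ if $m<d$ and $m^*=\infty$ if $m\ge d$, and let $\tilde s=\min(s,2)$. Let $\boldsymbol U=W^{1,r}_0(\Omega)^d$ be the space of the $W^{1,r}(\Omega)^d$ fields vanishing on $\partial\Omega$, i.e. the closure of $C_c^\infty(\Omega)^d$ in $W^{1,r}(\Omega)^d$, and let $|\boldsymbol v|_{W^{1,p}(\Omega)^d}=\|\nabla\boldsymbol v\|_{L^p(\Omega)^{d\times d}}$ (with the Frobenius norm on matrices). Let $m\in[1,r]$ be such that $s\le \frac{m^*}{m'}$ (where $\frac{m^*}{m'}=0$ if $m=1$ and $\frac{m^*}{m'}=\infty$ if $m\ge d$). Then there is a constant $C>0$, depending only on $m,r,s,d,\Omega$, such that the following holds for every $\chi_{\mathrm{hc}}\in(0,\infty)$ and every measurable $\boldsymbol\chi:\Omega\times\mathbb R^d\to\mathbb R^d$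 such that, for almost every $\boldsymbol x\in\Omega$, $\boldsymbol\chi(\boldsymbol x,\boldsymbol 0)=\boldsymbol 0$ and $$|\boldsymbol\chi(\boldsymbol x,\boldsymbol w)-\boldsymbol\chi(\boldsymbol x,\boldsymbol v)|\le\chi_{\mathrm{hc}}\left(|\boldsymbol w|^s+|\boldsymbol v|^s\right)^{\frac{s-\tilde s}{s}}|\boldsymbol w-\boldsymbol v|^{\tilde s-1}\qquad\text{for all }\boldsymbol v,\boldsymbol w\in\mathbb R^d.$$ For all $\boldsymbol w,\boldsymbol v\in\boldsymbol U$ the three integrals in $$c(\boldsymbol w,\boldsymbol v)=\frac1s\int_\Omega(\boldsymbol\chi(\cdot,\boldsymbol w)\cdot\nabla)\boldsymbol w\cdot\boldsymbol v+\frac{s-2}{s}\int_\Omega\frac{\boldsymbol v\cdot\boldsymbol w}{|\boldsymbol w|^2}(\boldsymbol\chi(\cdot,\boldsymbol w)\cdot\nabla)\boldsymbol w\cdot\boldsymbol w-\frac1{s'}\int_\Omega(\boldsymbol\chi(\cdot,\boldsymbol w)\cdot\nabla)\boldsymbol v\cdot\boldsymbol w$$ converge absolutely (the second integrand being $0$ where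 $\boldsymbol w=\boldsymbol 0$), and for all $\boldsymbol u,\boldsymbol v,\boldsymbol w\in\boldsymbol U$ $$|c(\boldsymbol u,\boldsymbol v)-c(\boldsymbol w,\boldsymbol v)|\le C\,\chi_{\mathrm{hc}}\left(|\boldsymbol u|_{W^{1,r}(\Omega)^d}^r+|\boldsymbol w|_{W^{1,r}(\Omega)^d}^r\right)^{\frac{s+1-\tilde s}{r}}|\boldsymbol u-\boldsymbol w|_{W^{1,m}(\Omega)^d}^{\tilde s-1}\,|\boldsymbol v|_{W^{1,m}(\Omega)^d}.$$ -/

import Mathlib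

open MeasureTheory Filter Topology
open scoped ENNReal ContDiff

noncomputable section

/-- The Sobolev exponent `m^*` in dimension `d`: `d m / (d - m)` if `m < d`, and `∞` if `m ≥ d`. -/
def sobolevExponent (d : ℕ) (m : ℝ≥0∞) : ℝ≥0∞ :=
  if m < d then d * m / (d - m) else ⊤

/-- The conjugate exponent `m'`: `m / (m - 1)` if `1 < m < ∞`, `∞` if `m = 1`, `1` if `m = ∞`. -/
def conjugateExponent (m : ℝ≥0∞) : ℝ≥0∞ :=
  if m = 1 then ⊤ else if m = ⊤ then 1 else m / (m - 1)

/-- The Frobenius norm of a real `d × d` matrix. -/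
def frobeniusNorm {d : ℕ} (A : Matrix (Fin d) (Fin d) ℝ) : ℝ :=
  Real.sqrt (∑ i, ∑ j, A i j ^ 2)

/-- `C_c^∞(Ω; F)`: smooth functions with compact support contained in `Ω`. -/
def IsTestFunction {d : ℕ} {F : Type*} [NormedAddCommGroup F] [NormedSpace ℝ F]
    (Ω : Set (EuclideanSpace ℝ (Fin d))) (φ : EuclideanSpace ℝ (Fin d) → F) : Prop :=
  ContDiff ℝ ∞ φ ∧ HasCompactSupport φ ∧ tsupport φ ⊆ Ω

/-- `G` is a weak gradient of the vector field `u` in `Ω`, with the convention `G i j = ∂_j u_i`. -/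
def IsWeakGradient {d : ℕ} (Ω : Set (EuclideanSpace ℝ (Fin d)))
    (u : EuclideanSpace ℝ (Fin d) → EuclideanSpace ℝ (Fin d))
    (G : EuclideanSpace ℝ (Fin d) → Matrix (Fin d) (Fin d) ℝ) : Prop :=
  LocallyIntegrableOn u Ω ∧
  ∀ i j, LocallyIntegrableOn (fun x => G x i j) Ω ∧
    ∀ φ : EuclideanSpace ℝ (Fin d) → ℝ, IsTestFunction Ω φ →
      ∫ x in Ω, u x i * fderiv ℝ φ x (EuclideanSpace.single j 1) = - ∫ x in Ω, G x i j * φ x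

open Classical in
/-- The weak gradient of `u` in `Ω` (unique up to a null set when it exists, and `0` otherwise). -/
def weakGradient {d : ℕ} (Ω : Set (EuclideanSpace ℝ (Fin d)))
    (u : EuclideanSpace ℝ (Fin d) → EuclideanSpace ℝ (Fin d)) :
    EuclideanSpace ℝ (Fin d) → Matrix (Fin d) (Fin d) ℝ :=
  if h : ∃ G, IsWeakGradient Ω u G then h.choose else 0

/-- `u ∈ W^{1,p}(Ω)^d`. -/
def MemSobolev {d : ℕ} (Ω : Set (EuclideanSpace ℝ (Fin d))) (p : ℝ≥0∞)
    (u : EuclideanSpace ℝ (Fin d) → EuclideanSpace ℝ (Fin d)) : Prop :=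
  MemLp u p (volume.restrict Ω) ∧
  ∃ G, IsWeakGradient Ω u G ∧ ∀ i j, MemLp (fun x => G x i j) p (volume.restrict Ω)

/-- The seminorm `|u|_{W^{1,p}(Ω)^d}`, the `L^p(Ω)` norm of the Frobenius norm of the weak gradient,
as an extended real. -/
def sobolevESeminorm {d : ℕ} (Ω : Set (EuclideanSpace ℝ (Fin d))) (p : ℝ≥0∞)
    (u : EuclideanSpace ℝ (Fin d) → EuclideanSpace ℝ (Fin d)) : ℝ≥0∞ :=
  eLpNorm (fun x => frobeniusNorm (weakGradient Ω u x)) p (volume.restrict Ω)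

/-- The seminorm `|u|_{W^{1,p}(Ω)^d}`. -/
def sobolevSeminorm {d : ℕ} (Ω : Set (EuclideanSpace ℝ (Fin d))) (p : ℝ≥0∞)
    (u : EuclideanSpace ℝ (Fin d) → EuclideanSpace ℝ (Fin d)) : ℝ :=
  (sobolevESeminorm Ω p u).toReal

/-- The velocity space: the fields of `W^{1,p}(Ω)^d` that vanish on `∂Ω`, i.e. `W_0^{1,p}(Ω)^d`,
the closure of `C_c^∞(Ω)^d` in `W^{1,p}(Ω)^d`. -/
def MemSobolevZero {d : ℕ} (Ω : Set (EuclideanSpace ℝ (Fin d))) (p : ℝ≥0∞)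
    (u : EuclideanSpace ℝ (Fin d) → EuclideanSpace ℝ (Fin d)) : Prop :=
  MemSobolev Ω p u ∧
  ∃ φ : ℕ → EuclideanSpace ℝ (Fin d) → EuclideanSpace ℝ (Fin d),
    (∀ n, IsTestFunction Ω (φ n)) ∧
    Tendsto (fun n => eLpNorm (u - φ n) p (volume.restrict Ω)) atTop (𝓝 0) ∧
    Tendsto (fun n => sobolevESeminorm Ω p (u - φ n)) atTop (𝓝 0)

/-- `χ : Ω × ℝ^d → ℝ^d` is (Lebesgue) measurable, vanishes at `0` and is Hölder continuous in its
second argument, with convection exponent `s` and constant `κ`. -/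
structure IsConvectionLaw {d : ℕ} (Ω : Set (EuclideanSpace ℝ (Fin d))) (s κ : ℝ)
    (χ : EuclideanSpace ℝ (Fin d) → EuclideanSpace ℝ (Fin d) → EuclideanSpace ℝ (Fin d)) :
    Prop where
  measurable : AEMeasurable
    (fun q : EuclideanSpace ℝ (Fin d) × EuclideanSpace ℝ (Fin d) => χ q.1 q.2)
    ((volume.restrict Ω).prod volume)
  zero : ∀ᵐ x ∂(volume.restrict Ω), χ x 0 = 0
  holder : ∀ᵐ x ∂(volume.restrict Ω), ∀ v w : EuclideanSpace ℝ (Fin d),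
    ‖χ x w - χ x v‖ ≤
      κ * (‖w‖ ^ s + ‖v‖ ^ s) ^ ((s - min s 2) / s) * ‖w - v‖ ^ (min s 2 - 1)

/-- `(b · ∇) w · z = ∑_{i,j} b_j (∂_j w_i) z_i`, where `A i j = ∂_j w_i`. -/
def advection {d : ℕ} (b : EuclideanSpace ℝ (Fin d)) (A : Matrix (Fin d) (Fin d) ℝ)
    (z : EuclideanSpace ℝ (Fin d)) : ℝ :=
  ∑ i, ∑ j, b j * A i j * z i

/-- The integrand `(χ(·,w) · ∇) w · v`. -/
def convIntegrand₁ {d : ℕ} (Ω : Set (EuclideanSpace ℝ (Fin d)))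
    (χ : EuclideanSpace ℝ (Fin d) → EuclideanSpace ℝ (Fin d) → EuclideanSpace ℝ (Fin d))
    (w v : EuclideanSpace ℝ (Fin d) → EuclideanSpace ℝ (Fin d))
    (x : EuclideanSpace ℝ (Fin d)) : ℝ :=
  advection (χ x (w x)) (weakGradient Ω w x) (v x)

/-- The integrand `((v · w) / |w|²) (χ(·,w) · ∇) w · w`, equal to `0` where `w = 0`. -/
def convIntegrand₂ {d : ℕ} (Ω : Set (EuclideanSpace ℝ (Fin d)))
    (χ : EuclideanSpace ℝ (Fin d) → EuclideanSpace ℝ (Fin d) → EuclideanSpace ℝ (Fin d))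
    (w v : EuclideanSpace ℝ (Fin d) → EuclideanSpace ℝ (Fin d))
    (x : EuclideanSpace ℝ (Fin d)) : ℝ :=
  inner ℝ (v x) (w x) / ‖w x‖ ^ 2 * advection (χ x (w x)) (weakGradient Ω w x) (w x)

/-- The integrand `(χ(·,w) · ∇) v · w`. -/
def convIntegrand₃ {d : ℕ} (Ω : Set (EuclideanSpace ℝ (Fin d)))
    (χ : EuclideanSpace ℝ (Fin d) → EuclideanSpace ℝ (Fin d) → EuclideanSpace ℝ (Fin d))
    (w v : EuclideanSpace ℝ (Fin d) → EuclideanSpace ℝ (Fin d))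
    (x : EuclideanSpace ℝ (Fin d)) : ℝ :=
  advection (χ x (w x)) (weakGradient Ω v x) (w x)

/-- The three integrals in the definition of `c(w,v)` converge absolutely. -/
def ConvIntegrable {d : ℕ} (Ω : Set (EuclideanSpace ℝ (Fin d)))
    (χ : EuclideanSpace ℝ (Fin d) → EuclideanSpace ℝ (Fin d) → EuclideanSpace ℝ (Fin d))
    (w v : EuclideanSpace ℝ (Fin d) → EuclideanSpace ℝ (Fin d)) : Prop :=
  IntegrableOn (convIntegrand₁ Ω χ w v) Ω ∧ IntegrableOn (convIntegrand₂ Ω χ w v) Ω ∧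
    IntegrableOn (convIntegrand₃ Ω χ w v) Ω

/-- The convective function `c(w,v)`; here `s' = s / (s - 1)`. -/
def convective {d : ℕ} (Ω : Set (EuclideanSpace ℝ (Fin d))) (s : ℝ)
    (χ : EuclideanSpace ℝ (Fin d) → EuclideanSpace ℝ (Fin d) → EuclideanSpace ℝ (Fin d))
    (w v : EuclideanSpace ℝ (Fin d) → EuclideanSpace ℝ (Fin d)) : ℝ :=
  1 / s * (∫ x in Ω, convIntegrand₁ Ω χ w v x)
    + (s - 2) / s * (∫ x in Ω, convIntegrand₂ Ω χ w v x)
    - 1 / (s / (s - 1)) * (∫ x in Ω, convIntegrand₃ Ω χ w v x)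

end

/-! Write `t = min s 2` and choose `q = s m'`, so that `s / q + 1 / m = 1`: a product of factors in
`L^q` of total degree `s` and one gradient in `L^m` is integrable by Hölder's inequality. The
hypothesis `s ≤ m^*/m'` says exactly `q ≤ m^*`, so the Sobolev inequality bounds the `L^q` norm of
every field of the velocity space by its gradient in `L^m`.

It remains to find a pointwise bound of the right homogeneity. With `N = |u| + |w|`, the difference
of the integrands of `c(u,v)` and `c(w,v)` is at most a multiple of `κ` times `N^(s-t) |u-w|^(t-1)
|v| |∇u| + N^(s-1) |v| |∇(u-w)| + N^(s+1-t) |u-w|^(t-1) |∇v|` (`abs_convective_integrand_sub_le`).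
The delicate integrand is the second, singular at `w = 0`: it is the advection tested against the
projection of `v` on the line of `w`. That projection is bounded by `|v|` and is Lipschitz in `w`
with constant of order `|v| / |w|`; interpolating the two bounds gives a `(t-1)`-Hölder estimate,
whose singular weight is absorbed by `|χ(w)| ≤ κ |w|^(s-1)` (`norm_rpow_mul_norm_lineProj_sub_le`).

Hölder and Sobolev turn the three terms into products of seminorms in `W^{1,m}`, which are all
dominated by one monomial (`IsConvectionLaw.enorm_convective_sub_le`). Since `Ω` is bounded, the
seminorms of `u` and `w` pass from exponent `m` to exponent `r`. -/

/-! ### Weak gradients: linearity, uniqueness, agreement with classical derivatives. -/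

section WeakGradient

variable {d : ℕ} {Ω : Set (EuclideanSpace ℝ (Fin d))}

/-- Only a compact subset of `Ω` matters: outside `tsupport g` the product vanishes, so possible
blow-up of `f` near `∂Ω` is harmless. -/
theorem LocallyIntegrableOn.integrable_mul_of_tsupport_subset
    {f g : EuclideanSpace ℝ (Fin d) → ℝ} (hf : LocallyIntegrableOn f Ω)
    (hg : Continuous g) (hgc : HasCompactSupport g) (hgs : tsupport g ⊆ Ω) :
    Integrable (fun x => f x * g x) := by
  have h1 : IntegrableOn f (tsupport g) := hf.integrableOn_compact_subset hgs hgc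
  have h2 : IntegrableOn (fun x => f x * g x) (tsupport g) :=
    h1.mul_continuousOn hg.continuousOn hgc
  refine (integrableOn_iff_integrable_of_support_subset ?_).1 h2
  intro x hx
  exact subset_tsupport g (right_ne_zero_of_mul hx)

theorem IsTestFunction.integrableOn_mul {f g : EuclideanSpace ℝ (Fin d) → ℝ}
    (hg : IsTestFunction Ω g) (hf : LocallyIntegrableOn f Ω) :
    IntegrableOn (fun x => f x * g x) Ω :=
  (LocallyIntegrableOn.integrable_mul_of_tsupport_subset hf hg.1.continuous hg.2.1
    hg.2.2).integrableOn

theorem IsTestFunction.integrableOn_mul_fderiv {f g : EuclideanSpace ℝ (Fin d) → ℝ}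
    (hg : IsTestFunction Ω g) (hf : LocallyIntegrableOn f Ω) (v : EuclideanSpace ℝ (Fin d)) :
    IntegrableOn (fun x => f x * fderiv ℝ g x v) Ω := by
  have hsub : tsupport (fun x => fderiv ℝ g x v) ⊆ tsupport g :=
    tsupport_fderiv_apply_subset ℝ v
  refine (LocallyIntegrableOn.integrable_mul_of_tsupport_subset hf ?_ ?_
    (hsub.trans hg.2.2)).integrableOn
  · exact (hg.1.continuous_fderiv (by simp)).clm_apply continuous_const
  · exact hg.2.1.fderiv_apply ℝ v

theorem LocallyIntegrableOn.euclidean_apply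
    {u : EuclideanSpace ℝ (Fin d) → EuclideanSpace ℝ (Fin d)} (hu : LocallyIntegrableOn u Ω)
    (i : Fin d) : LocallyIntegrableOn (fun x => u x i) Ω := by
  intro x hx
  obtain ⟨s, hs, h⟩ := hu x hx
  exact ⟨s, hs, (EuclideanSpace.proj (𝕜 := ℝ) i).integrable_comp h⟩

theorem IsWeakGradient.sub {u v : EuclideanSpace ℝ (Fin d) → EuclideanSpace ℝ (Fin d)}
    {G H : EuclideanSpace ℝ (Fin d) → Matrix (Fin d) (Fin d) ℝ}
    (hu : IsWeakGradient Ω u G) (hv : IsWeakGradient Ω v H) :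
    IsWeakGradient Ω (u - v) (G - H) := by
  refine ⟨hu.1.sub hv.1, fun i j => ⟨(hu.2 i j).1.sub (hv.2 i j).1, fun φ hφ => ?_⟩⟩
  have e1 := (hu.2 i j).2 φ hφ
  have e2 := (hv.2 i j).2 φ hφ
  simp only [Pi.sub_apply, PiLp.sub_apply, Matrix.sub_apply, sub_mul]
  rw [integral_sub (hφ.integrableOn_mul_fderiv (LocallyIntegrableOn.euclidean_apply hu.1 i) _)
    (hφ.integrableOn_mul_fderiv (LocallyIntegrableOn.euclidean_apply hv.1 i) _),
    integral_sub (hφ.integrableOn_mul (hu.2 i j).1) (hφ.integrableOn_mul (hv.2 i j).1), e1, e2]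
  ring

/-- Fundamental lemma of the calculus of variations, entry by entry. -/
theorem IsWeakGradient.ae_eq (hΩ : IsOpen Ω)
    {u : EuclideanSpace ℝ (Fin d) → EuclideanSpace ℝ (Fin d)}
    {G H : EuclideanSpace ℝ (Fin d) → Matrix (Fin d) (Fin d) ℝ}
    (hG : IsWeakGradient Ω u G) (hH : IsWeakGradient Ω u H) :
    G =ᵐ[volume.restrict Ω] H := by
  have key : ∀ i j, ∀ᵐ x ∂(volume.restrict Ω), G x i j = H x i j := by
    intro i j
    rw [ae_restrict_iff' hΩ.measurableSet]
    have h := hΩ.ae_eq_zero_of_integral_contDiff_smul_eq_zero (μ := volume)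
      (f := fun x => G x i j - H x i j) ((hG.2 i j).1.sub (hH.2 i j).1) ?_
    · filter_upwards [h] with x hx hxΩ using sub_eq_zero.1 (hx hxΩ)
    · intro g hg hgc hgs
      have hφ : IsTestFunction Ω g := ⟨hg, hgc, hgs⟩
      have e1 := (hG.2 i j).2 g hφ
      have e2 := (hH.2 i j).2 g hφ
      have e3 : ∫ x in Ω, (G x i j * g x - H x i j * g x) = 0 := by
        rw [integral_sub (hφ.integrableOn_mul (hG.2 i j).1) (hφ.integrableOn_mul (hH.2 i j).1)]
        linarith
      rw [← e3, setIntegral_eq_integral_of_forall_compl_eq_zero]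
      · exact integral_congr_ae (Eventually.of_forall fun x => by simp; ring)
      · intro x hx
        have : g x = 0 := image_eq_zero_of_notMem_tsupport fun h => hx (hgs h)
        simp [this]
  have := ae_all_iff.2 fun i => ae_all_iff.2 fun j => key i j
  filter_upwards [this] with x hx
  ext i j
  exact hx i j

theorem IsWeakGradient.weakGradient {u : EuclideanSpace ℝ (Fin d) → EuclideanSpace ℝ (Fin d)}
    {G : EuclideanSpace ℝ (Fin d) → Matrix (Fin d) (Fin d) ℝ} (hG : IsWeakGradient Ω u G) :
    IsWeakGradient Ω u (weakGradient Ω u) := by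
  have h : ∃ G, IsWeakGradient Ω u G := ⟨G, hG⟩
  rw [_root_.weakGradient, dif_pos h]
  exact h.choose_spec

/-- `weakGradient` is an arbitrary choice; every computation with it goes through this almost
everywhere identification. -/
theorem IsWeakGradient.weakGradient_ae_eq (hΩ : IsOpen Ω)
    {u : EuclideanSpace ℝ (Fin d) → EuclideanSpace ℝ (Fin d)}
    {G : EuclideanSpace ℝ (Fin d) → Matrix (Fin d) (Fin d) ℝ} (hG : IsWeakGradient Ω u G) :
    _root_.weakGradient Ω u =ᵐ[volume.restrict Ω] G :=
  hG.weakGradient.ae_eq hΩ hG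

/-- Since `ψ` has compact support in `Ω`, both integrals extend to the whole space, where
integration by parts has no boundary term. -/
theorem IsTestFunction.isWeakGradient
    {φ : EuclideanSpace ℝ (Fin d) → EuclideanSpace ℝ (Fin d)} (hφ : IsTestFunction Ω φ) :
    IsWeakGradient Ω φ
      (fun x => Matrix.of fun i j => fderiv ℝ φ x (EuclideanSpace.single j 1) i) := by
  have hcont : Continuous (fderiv ℝ φ) := hφ.1.continuous_fderiv (by simp)
  have hcoord (i : Fin d) : ContDiff ℝ ∞ (fun x => φ x i) :=
    (EuclideanSpace.proj (𝕜 := ℝ) i).contDiff.comp hφ.1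
  have hder (i : Fin d) (x v : EuclideanSpace ℝ (Fin d)) :
      fderiv ℝ (fun x => φ x i) x v = fderiv ℝ φ x v i := by
    have h1 := (hφ.1.differentiable (by simp) x).hasFDerivAt
    have h2 := ((EuclideanSpace.proj (𝕜 := ℝ) i).hasFDerivAt.comp x h1).fderiv
    change fderiv ℝ ((EuclideanSpace.proj (𝕜 := ℝ) i) ∘ φ) x v = _
    rw [h2]; rfl
  have hdc (i j : Fin d) :
      Continuous fun x => fderiv ℝ φ x (EuclideanSpace.single j 1) i :=
    (EuclideanSpace.proj (𝕜 := ℝ) i).continuous.comp (hcont.clm_apply continuous_const)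
  refine ⟨(hφ.1.continuous.locallyIntegrable).locallyIntegrableOn Ω, fun i j =>
    ⟨(hdc i j).locallyIntegrable.locallyIntegrableOn Ω, fun ψ hψ => ?_⟩⟩
  have i1 : Integrable fun x => fderiv ℝ φ x (EuclideanSpace.single j 1) i * ψ x :=
    LocallyIntegrableOn.integrable_mul_of_tsupport_subset
      ((hdc i j).locallyIntegrable.locallyIntegrableOn Ω) hψ.1.continuous hψ.2.1 hψ.2.2
  have i2 : Integrable fun x => φ x i * ψ x :=
    LocallyIntegrableOn.integrable_mul_of_tsupport_subset
      ((hcoord i).continuous.locallyIntegrable.locallyIntegrableOn Ω) hψ.1.continuous hψ.2.1 hψ.2.2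
  have hsub : tsupport (fun x => fderiv ℝ ψ x (EuclideanSpace.single j 1)) ⊆ tsupport ψ :=
    tsupport_fderiv_apply_subset ℝ _
  have i3 : Integrable fun x => φ x i * fderiv ℝ ψ x (EuclideanSpace.single j 1) :=
    LocallyIntegrableOn.integrable_mul_of_tsupport_subset
      ((hcoord i).continuous.locallyIntegrable.locallyIntegrableOn Ω)
      ((hψ.1.continuous_fderiv (by simp)).clm_apply continuous_const)
      (hψ.2.1.fderiv_apply ℝ _) (hsub.trans hψ.2.2)
  have key := integral_mul_fderiv_eq_neg_fderiv_mul_of_integrable (μ := volume)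
    (f := fun x => φ x i) (g := ψ) (v := EuclideanSpace.single j 1)
    (by simpa only [hder] using i1) i3 i2
    (fun x _ => (hcoord i).differentiable (by simp) x)
    (fun x _ => hψ.1.differentiable (by simp) x)
  simp only [hder] at key
  have hz (x) (hx : x ∉ Ω) : x ∉ tsupport ψ := fun h => hx (hψ.2.2 h)
  rw [setIntegral_eq_integral_of_forall_compl_eq_zero, key,
    setIntegral_eq_integral_of_forall_compl_eq_zero]
  · rfl
  · intro x hx
    simp [image_eq_zero_of_notMem_tsupport (hz x hx)]
  · intro x hx
    have : fderiv ℝ ψ x (EuclideanSpace.single j 1) = 0 :=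
      image_eq_zero_of_notMem_tsupport
        (f := fun y => fderiv ℝ ψ y (EuclideanSpace.single j 1)) fun h => hz x hx (hsub h)
    simp [this]

end WeakGradient

/-! ### The Frobenius norm as a Euclidean norm. -/

section Frobenius

variable {d : ℕ}

/-- A square matrix as a vector of the Euclidean space whose norm is the Frobenius norm. -/
def frobeniusVec (A : Matrix (Fin d) (Fin d) ℝ) : EuclideanSpace ℝ (Fin d × Fin d) :=
  WithLp.toLp 2 fun q => A q.1 q.2

@[simp] theorem frobeniusVec_apply (A : Matrix (Fin d) (Fin d) ℝ) (q : Fin d × Fin d) :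
    frobeniusVec A q = A q.1 q.2 := rfl

theorem norm_frobeniusVec (A : Matrix (Fin d) (Fin d) ℝ) : ‖frobeniusVec A‖ = frobeniusNorm A := by
  simp [EuclideanSpace.norm_eq, frobeniusNorm, Fintype.sum_prod_type]

theorem frobeniusVec_sub (A B : Matrix (Fin d) (Fin d) ℝ) :
    frobeniusVec (A - B) = frobeniusVec A - frobeniusVec B := by
  ext q; simp

theorem frobeniusNorm_nonneg (A : Matrix (Fin d) (Fin d) ℝ) : 0 ≤ frobeniusNorm A :=
  Real.sqrt_nonneg _

/-- The advection is the Frobenius inner product of `A` with the rank-one matrix `z ⊗ b`, of norm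
`‖b‖ * ‖z‖`; then Cauchy–Schwarz. -/
theorem abs_advection_le (b z : EuclideanSpace ℝ (Fin d)) (A : Matrix (Fin d) (Fin d) ℝ) :
    |advection b A z| ≤ ‖b‖ * frobeniusNorm A * ‖z‖ := by
  have h1 : advection b A z =
      inner ℝ (frobeniusVec A) (frobeniusVec (Matrix.of fun i j => b j * z i)) := by
    simp only [advection, PiLp.inner_apply, Fintype.sum_prod_type]
    refine Finset.sum_congr rfl fun i _ => Finset.sum_congr rfl fun j _ => ?_
    simp
    ring
  have h2 : ‖frobeniusVec (Matrix.of fun i j => b j * z i)‖ = ‖b‖ * ‖z‖ := by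
    rw [EuclideanSpace.norm_eq, EuclideanSpace.norm_eq, EuclideanSpace.norm_eq,
      ← Real.sqrt_mul (by positivity), Finset.sum_mul_sum, Fintype.sum_prod_type,
      Finset.sum_comm]
    simp [mul_pow]
  rw [h1]
  refine (abs_real_inner_le_norm _ _).trans_eq ?_
  rw [h2, norm_frobeniusVec]
  ring

/-- Links the Sobolev inequality, stated with the operator norm of the derivative, to the Frobenius
seminorm. Testing the advection bound with `z = T v` gives `‖T v‖²` on the left. -/
theorem norm_le_frobeniusNorm (T : EuclideanSpace ℝ (Fin d) →L[ℝ] EuclideanSpace ℝ (Fin d)) :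
    ‖T‖ ≤ frobeniusNorm (Matrix.of fun i j => T (EuclideanSpace.single j 1) i) := by
  refine T.opNorm_le_bound (frobeniusNorm_nonneg _) fun v => ?_
  set A : Matrix (Fin d) (Fin d) ℝ := Matrix.of fun i j => T (EuclideanSpace.single j 1) i
  have hv : T v = ∑ j, v j • T (EuclideanSpace.single j 1) := by
    have : v = ∑ j, v j • EuclideanSpace.single j (1 : ℝ) := by
      ext i
      simp [Finset.sum_apply, Pi.single_apply]
    conv_lhs => rw [this]
    simp
  have h1 : advection v A (T v) = ‖T v‖ * ‖T v‖ := by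
    rw [← real_inner_self_eq_norm_mul_norm, PiLp.inner_apply]
    unfold advection
    refine Finset.sum_congr rfl fun i _ => ?_
    rw [← Finset.sum_mul]
    have : T v i = ∑ j, v j * A i j := by
      conv_lhs => rw [hv]
      simp [A]
    rw [← this]
    simp [sq]
  have h2 := (le_abs_self _).trans (abs_advection_le v (T v) A)
  rw [h1] at h2
  rcases (norm_nonneg (T v)).eq_or_lt with h0 | h0
  · rw [← h0]; exact mul_nonneg (frobeniusNorm_nonneg _) (norm_nonneg _)
  · rw [mul_comm (frobeniusNorm A)]
    exact le_of_mul_le_mul_right h2 h0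

end Frobenius

/-! ### Sobolev spaces and their seminorms. -/

section Sobolev

variable {d : ℕ} {Ω : Set (EuclideanSpace ℝ (Fin d))} {p : ℝ≥0∞}
  {u v : EuclideanSpace ℝ (Fin d) → EuclideanSpace ℝ (Fin d)}

theorem sobolevESeminorm_eq_eLpNorm (Ω : Set (EuclideanSpace ℝ (Fin d))) (p : ℝ≥0∞)
    (u : EuclideanSpace ℝ (Fin d) → EuclideanSpace ℝ (Fin d)) :
    sobolevESeminorm Ω p u =
      eLpNorm (fun x => frobeniusVec (weakGradient Ω u x)) p (volume.restrict Ω) := by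
  unfold sobolevESeminorm
  refine eLpNorm_congr_norm_ae (Eventually.of_forall fun x => ?_)
  rw [norm_frobeniusVec, Real.norm_of_nonneg (frobeniusNorm_nonneg _)]

theorem MemSobolev.isWeakGradient (hu : MemSobolev Ω p u) :
    IsWeakGradient Ω u (weakGradient Ω u) :=
  let ⟨_, hG, _⟩ := hu.2
  hG.weakGradient

theorem MemSobolev.memLp_weakGradient (hΩ : IsOpen Ω) (hu : MemSobolev Ω p u) (i j : Fin d) :
    MemLp (fun x => weakGradient Ω u x i j) p (volume.restrict Ω) := by
  obtain ⟨G, hG, hGp⟩ := hu.2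
  refine (hGp i j).ae_eq ?_
  filter_upwards [hG.weakGradient_ae_eq hΩ] with x hx
  rw [hx]

theorem MemSobolev.memLp_frobeniusVec (hΩ : IsOpen Ω) (hu : MemSobolev Ω p u) :
    MemLp (fun x => frobeniusVec (weakGradient Ω u x)) p (volume.restrict Ω) :=
  MemLp.of_eval_piLp fun q => hu.memLp_weakGradient hΩ q.1 q.2

theorem IsTestFunction.memSobolev {φ : EuclideanSpace ℝ (Fin d) → EuclideanSpace ℝ (Fin d)}
    (hφ : IsTestFunction Ω φ) : MemSobolev Ω p φ := by
  have hcont : Continuous (fderiv ℝ φ) := hφ.1.continuous_fderiv (by simp)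
  refine ⟨(hφ.1.continuous.memLp_of_hasCompactSupport hφ.2.1).restrict Ω, _, hφ.isWeakGradient,
    fun i j => ?_⟩
  refine (Continuous.memLp_of_hasCompactSupport (X := EuclideanSpace ℝ (Fin d))
    ((EuclideanSpace.proj (𝕜 := ℝ) i).continuous.comp (hcont.clm_apply continuous_const))
    ?_).restrict Ω
  exact (hφ.2.1.fderiv_apply ℝ (EuclideanSpace.single j 1)).comp_left
    (g := fun y : EuclideanSpace ℝ (Fin d) => y i) rfl

theorem IsTestFunction.sub {φ ψ : EuclideanSpace ℝ (Fin d) → EuclideanSpace ℝ (Fin d)}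
    (hφ : IsTestFunction Ω φ) (hψ : IsTestFunction Ω ψ) : IsTestFunction Ω (φ - ψ) :=
  ⟨hφ.1.sub hψ.1, hφ.2.1.sub hψ.2.1,
    (tsupport_sub φ ψ).trans (Set.union_subset hφ.2.2 hψ.2.2)⟩

theorem MemSobolev.sub (hu : MemSobolev Ω p u) (hv : MemSobolev Ω p v) :
    MemSobolev Ω p (u - v) := by
  obtain ⟨G, hG, hGp⟩ := hu.2
  obtain ⟨H, hH, hHp⟩ := hv.2
  exact ⟨hu.1.sub hv.1, G - H, hG.sub hH, fun i j => (hGp i j).sub (hHp i j)⟩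

theorem MemSobolev.weakGradient_sub (hΩ : IsOpen Ω) (hu : MemSobolev Ω p u)
    (hv : MemSobolev Ω p v) : weakGradient Ω (u - v) =ᵐ[volume.restrict Ω]
      weakGradient Ω u - weakGradient Ω v :=
  (hu.isWeakGradient.sub hv.isWeakGradient).weakGradient_ae_eq hΩ

/-- The exponent `t` is independent of `p`: fields of `W^{1,r}` are later measured in the seminorm
of exponent `m`. -/
theorem MemSobolev.sobolevESeminorm_sub_eq (hΩ : IsOpen Ω) (hu : MemSobolev Ω p u)
    (hv : MemSobolev Ω p v) (t : ℝ≥0∞) : sobolevESeminorm Ω t (u - v) =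
      eLpNorm ((fun x => frobeniusVec (weakGradient Ω u x)) -
        fun x => frobeniusVec (weakGradient Ω v x)) t (volume.restrict Ω) := by
  rw [sobolevESeminorm_eq_eLpNorm]
  refine eLpNorm_congr_ae ?_
  filter_upwards [hu.weakGradient_sub hΩ hv] with x hx
  rw [hx, Pi.sub_apply, Pi.sub_apply, frobeniusVec_sub]

theorem MemSobolev.sobolevESeminorm_sub_le (hΩ : IsOpen Ω) (hp : 1 ≤ p) (hu : MemSobolev Ω p u)
    (hv : MemSobolev Ω p v) :
    sobolevESeminorm Ω p (u - v) ≤ sobolevESeminorm Ω p u + sobolevESeminorm Ω p v := by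
  rw [hu.sobolevESeminorm_sub_eq hΩ hv, sobolevESeminorm_eq_eLpNorm, sobolevESeminorm_eq_eLpNorm]
  exact eLpNorm_sub_le (hu.memLp_frobeniusVec hΩ).1 (hv.memLp_frobeniusVec hΩ).1 hp

theorem MemSobolev.sobolevESeminorm_ne_top (hΩ : IsOpen Ω) (hu : MemSobolev Ω p u) :
    sobolevESeminorm Ω p u ≠ ⊤ := by
  rw [sobolevESeminorm_eq_eLpNorm]
  exact (hu.memLp_frobeniusVec hΩ).2.ne

theorem MemSobolevZero.sub (hΩ : IsOpen Ω) (hp : 1 ≤ p) (hu : MemSobolevZero Ω p u)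
    (hv : MemSobolevZero Ω p v) : MemSobolevZero Ω p (u - v) := by
  obtain ⟨hu1, φ, hφ, hφ1, hφ2⟩ := hu
  obtain ⟨hv1, ψ, hψ, hψ1, hψ2⟩ := hv
  have hcomm (n : ℕ) : u - v - (φ n - ψ n) = (u - φ n) - (v - ψ n) := sub_sub_sub_comm _ _ _ _
  refine ⟨hu1.sub hv1, fun n => φ n - ψ n, fun n => (hφ n).sub (hψ n), ?_, ?_⟩
  · refine tendsto_of_tendsto_of_tendsto_of_le_of_le tendsto_const_nhds
      (by simpa using hφ1.add hψ1) (fun n => zero_le) fun n => ?_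
    simp only [hcomm]
    exact eLpNorm_sub_le (hu1.1.sub (hφ n).memSobolev.1).1 (hv1.1.sub (hψ n).memSobolev.1).1 hp
  · refine tendsto_of_tendsto_of_tendsto_of_le_of_le tendsto_const_nhds
      (by simpa using hφ2.add hψ2) (fun n => zero_le) fun n => ?_
    simp only [hcomm]
    exact (hu1.sub (hφ n).memSobolev).sobolevESeminorm_sub_le hΩ hp (hv1.sub (hψ n).memSobolev)

end Sobolev

/-! ### The Sobolev inequality on `W_0^{1,r}` with the gradient in `L^m`. -/

section SobolevInequality

variable {d : ℕ} {Ω : Set (EuclideanSpace ℝ (Fin d))}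

theorem sobolevESeminorm_le_mul_of_le (hΩ : IsOpen Ω) {p q t : ℝ≥0∞} (hpq : p ≤ q)
    {u : EuclideanSpace ℝ (Fin d) → EuclideanSpace ℝ (Fin d)} (hu : MemSobolev Ω t u) :
    sobolevESeminorm Ω p u ≤
      sobolevESeminorm Ω q u * volume Ω ^ (1 / p.toReal - 1 / q.toReal) := by
  rw [sobolevESeminorm_eq_eLpNorm, sobolevESeminorm_eq_eLpNorm, ← Measure.restrict_apply_univ Ω]
  exact eLpNorm_le_eLpNorm_mul_rpow_measure_univ hpq (hu.memLp_frobeniusVec hΩ).1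

theorem rpow_volume_ne_top (hΩb : Bornology.IsBounded Ω) {p q : ℝ} (hp : 0 < p) (hpq : p ≤ q) :
    volume Ω ^ (1 / (ENNReal.ofReal p).toReal - 1 / (ENNReal.ofReal q).toReal) ≠ ⊤ := by
  rw [ENNReal.toReal_ofReal hp.le, ENNReal.toReal_ofReal (hp.le.trans hpq)]
  exact ENNReal.rpow_ne_top_of_nonneg
    (sub_nonneg.2 (one_div_le_one_div_of_le hp hpq)) hΩb.measure_lt_top.ne

/-- The Gagliardo–Nirenberg–Sobolev inequality needs an exponent below `d`. For `m ≥ d` the gradient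
is first measured in a smaller `L^p`, at the cost of a power of the volume of `Ω`. -/
theorem exists_const_eLpNorm_le_of_isTestFunction (hd : 1 < d) (hΩ : IsOpen Ω)
    (hΩb : Bornology.IsBounded Ω) {m q : ℝ} (hm : 1 ≤ m) (hq : 0 < q)
    (hmq : m < d → m⁻¹ - (d : ℝ)⁻¹ ≤ q⁻¹) :
    ∃ C : ℝ≥0∞, C ≠ ⊤ ∧ ∀ φ : EuclideanSpace ℝ (Fin d) → EuclideanSpace ℝ (Fin d),
      IsTestFunction Ω φ → eLpNorm φ (ENNReal.ofReal q) (volume.restrict Ω) ≤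
        C * sobolevESeminorm Ω (ENNReal.ofReal m) φ := by
  have hd0 : (1 : ℝ) < d := by exact_mod_cast hd
  obtain ⟨p, hp1, hpd, hpm, hpq⟩ :
      ∃ p : ℝ, 1 ≤ p ∧ p < d ∧ p ≤ m ∧ p⁻¹ - (d : ℝ)⁻¹ ≤ q⁻¹ := by
    rcases lt_or_ge m d with h | h
    · exact ⟨m, hm, h, le_rfl, hmq h⟩
    -- The exponent whose Sobolev conjugate is `q`; it is raised to `1` if it is smaller, and stays
    -- below `d` because `1 < d`.
    · have hlt : ((d : ℝ)⁻¹ + q⁻¹)⁻¹ < d := by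
        rw [inv_lt_comm₀ (by positivity) (by positivity)]
        exact lt_add_of_pos_right _ (by positivity)
      have hmax : max 1 ((d : ℝ)⁻¹ + q⁻¹)⁻¹ < d := max_lt hd0 hlt
      refine ⟨_, le_max_left _ _, hmax, hmax.le.trans h, ?_⟩
      have : (max 1 ((d : ℝ)⁻¹ + q⁻¹)⁻¹)⁻¹ ≤ (d : ℝ)⁻¹ + q⁻¹ := by
        rw [inv_le_comm₀ (by positivity) (by positivity)]
        exact le_max_right _ _
      linarith
  have hp0 : 0 < p := by linarith
  refine ⟨eLpNormLESNormFDerivOfLeConst (EuclideanSpace ℝ (Fin d))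
      (volume : Measure (EuclideanSpace ℝ (Fin d))) Ω p.toNNReal q.toNNReal *
    volume Ω ^ (1 / (ENNReal.ofReal p).toReal - 1 / (ENNReal.ofReal m).toReal),
    ENNReal.mul_ne_top ENNReal.coe_ne_top (rpow_volume_ne_top hΩb hp0 hpm), fun φ hφ => ?_⟩
  have hsob := eLpNorm_le_eLpNorm_fderiv_of_le (μ := volume) (hφ.1.of_le (by simp))
    ((subset_tsupport φ).trans hφ.2.2) (p := p.toNNReal) (q := q.toNNReal)
    (by simpa using hp1) (by
      rw [finrank_euclideanSpace_fin]
      exact (Real.toNNReal_lt_natCast (by omega)).2 hpd)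
    (by
      rw [finrank_euclideanSpace_fin]
      simpa [Real.coe_toNNReal _ hp0.le, Real.coe_toNNReal _ hq.le] using hpq) hΩb
  have hsupp : Function.support (fun x => ‖fderiv ℝ φ x‖) ⊆ Ω := by
    intro x hx
    exact hφ.2.2 (tsupport_fderiv_subset ℝ (subset_tsupport _ (norm_ne_zero_iff.1 hx)))
  have hgrad : eLpNorm (fderiv ℝ φ) (ENNReal.ofReal p) volume ≤
      sobolevESeminorm Ω (ENNReal.ofReal p) φ := by
    rw [← eLpNorm_norm, ← eLpNorm_restrict_eq_of_support_subset hsupp, eLpNorm_norm]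
    refine eLpNorm_mono_ae ?_
    filter_upwards [hφ.isWeakGradient.weakGradient_ae_eq hΩ] with x hx
    rw [hx, Real.norm_of_nonneg (frobeniusNorm_nonneg _)]
    exact norm_le_frobeniusNorm _
  calc eLpNorm φ (ENNReal.ofReal q) (volume.restrict Ω)
      ≤ eLpNorm φ (ENNReal.ofReal q) volume := eLpNorm_mono_measure _ Measure.restrict_le_self
    _ ≤ _ := hsob
    _ ≤ _ := mul_le_mul_right (hgrad.trans (sobolevESeminorm_le_mul_of_le hΩ
        (ENNReal.ofReal_le_ofReal hpm) (hφ.memSobolev (p := 1)))) _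
    _ = _ := by ring

/-- Density and Fatou: test functions converging to `u` in `W^{1,r}` converge almost everywhere
along a subsequence, so the `L^q` norm is lower semicontinuous, while the seminorms of exponent `m`
are controlled in the limit by that of `u`. Membership of `u` in `L^q` need not be known beforehand.
-/
theorem exists_const_eLpNorm_le_of_memSobolevZero (hd : 1 < d) (hΩ : IsOpen Ω)
    (hΩb : Bornology.IsBounded Ω) {m q r : ℝ} (hm : 1 ≤ m) (hmr : m ≤ r) (hq : 0 < q)
    (hmq : m < d → m⁻¹ - (d : ℝ)⁻¹ ≤ q⁻¹) :
    ∃ C : ℝ≥0∞, C ≠ ⊤ ∧ ∀ u : EuclideanSpace ℝ (Fin d) → EuclideanSpace ℝ (Fin d),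
      MemSobolevZero Ω (ENNReal.ofReal r) u →
        eLpNorm u (ENNReal.ofReal q) (volume.restrict Ω) ≤
          C * sobolevESeminorm Ω (ENNReal.ofReal m) u := by
  obtain ⟨C, hC, h⟩ := exists_const_eLpNorm_le_of_isTestFunction hd hΩ hΩb hm hq hmq
  refine ⟨C, hC, ?_⟩
  rintro u ⟨hu, φ, hφ, hφ1, hφ2⟩
  have hm1 : 1 ≤ ENNReal.ofReal m := by simpa using hm
  have hr0 : ENNReal.ofReal r ≠ 0 := by simpa using by linarith
  set K := volume Ω ^ (1 / (ENNReal.ofReal m).toReal - 1 / (ENNReal.ofReal r).toReal) with hK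
  have hKt : K ≠ ⊤ := rpow_volume_ne_top hΩb (by linarith) hmr
  have hmeas := tendstoInMeasure_of_tendsto_eLpNorm hr0
    (fun n => (hφ n).1.continuous.aestronglyMeasurable) hu.1.1
    (f := φ) (g := u) (μ := volume.restrict Ω) (by
      refine hφ1.congr fun n => ?_
      rw [eLpNorm_sub_comm])
  obtain ⟨ns, hns, hae⟩ := hmeas.exists_seq_tendsto_ae
  have hbound (n : ℕ) : eLpNorm (φ (ns n)) (ENNReal.ofReal q) (volume.restrict Ω) ≤
      C * (sobolevESeminorm Ω (ENNReal.ofReal m) u +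
        sobolevESeminorm Ω (ENNReal.ofReal r) (u - φ (ns n)) * K) := by
    refine (h _ (hφ _)).trans (mul_le_mul_right ?_ _)
    have hφm : MemSobolev Ω (ENNReal.ofReal r) (φ (ns n)) := (hφ _).memSobolev
    calc sobolevESeminorm Ω (ENNReal.ofReal m) (φ (ns n))
        = sobolevESeminorm Ω (ENNReal.ofReal m) (u - (u - φ (ns n))) := by rw [sub_sub_cancel]
      _ ≤ sobolevESeminorm Ω (ENNReal.ofReal m) u +
          sobolevESeminorm Ω (ENNReal.ofReal m) (u - φ (ns n)) := by
        rw [hu.sobolevESeminorm_sub_eq hΩ (hu.sub hφm), sobolevESeminorm_eq_eLpNorm,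
          sobolevESeminorm_eq_eLpNorm]
        exact eLpNorm_sub_le (hu.memLp_frobeniusVec hΩ).1
          ((hu.sub hφm).memLp_frobeniusVec hΩ).1 hm1
      _ ≤ _ := add_le_add_right (sobolevESeminorm_le_mul_of_le hΩ
          (ENNReal.ofReal_le_ofReal hmr) (hu.sub hφm)) _
  have hlim : Tendsto (fun n => C * (sobolevESeminorm Ω (ENNReal.ofReal m) u +
        sobolevESeminorm Ω (ENNReal.ofReal r) (u - φ (ns n)) * K)) atTop
      (𝓝 (C * sobolevESeminorm Ω (ENNReal.ofReal m) u)) := by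
    have h1 := ENNReal.Tendsto.mul_const (hφ2.comp hns.tendsto_atTop) (b := K) (Or.inr hKt)
    have h2 := ENNReal.Tendsto.const_mul
      (tendsto_const_nhds.add h1 : Tendsto (fun n => sobolevESeminorm Ω (ENNReal.ofReal m) u + _)
        _ _) (a := C) (Or.inr hC)
    simpa using h2
  calc eLpNorm u (ENNReal.ofReal q) (volume.restrict Ω)
      ≤ liminf (fun n => eLpNorm (φ (ns n)) (ENNReal.ofReal q) (volume.restrict Ω)) atTop :=
        Lp.eLpNorm_lim_le_liminf_eLpNorm
          (fun n => (hφ _).1.continuous.aestronglyMeasurable) u hae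
    _ ≤ liminf (fun n => C * (sobolevESeminorm Ω (ENNReal.ofReal m) u +
        sobolevESeminorm Ω (ENNReal.ofReal r) (u - φ (ns n)) * K)) atTop :=
        liminf_le_liminf (Eventually.of_forall hbound)
    _ = _ := hlim.liminf_eq

end SobolevInequality

/-! ### Measurability of `x ↦ χ(x, w(x))`. -/

section Caratheodory

/-- Superposition of a Carathéodory function with a measurable function. -/
theorem aestronglyMeasurable_superposition {α E F : Type*} [MeasurableSpace α] {μ : Measure α}
    [SFinite μ] [NormedAddCommGroup E] [MeasurableSpace E] [BorelSpace E]
    [SecondCountableTopology E] {ν : Measure E} [SFinite ν] [ν.IsOpenPosMeasure]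
    [NormedAddCommGroup F] {χ : α → E → F}
    (hχ : AEStronglyMeasurable (fun q : α × E => χ q.1 q.2) (μ.prod ν))
    (hc : ∀ᵐ x ∂μ, Continuous (χ x)) {w : α → E} (hw : AEStronglyMeasurable w μ) :
    AEStronglyMeasurable (fun x => χ x (w x)) μ := by
  -- Joint a.e. measurability controls the sections `χ(·, v)` only for almost every `v`; such `v`
  -- are dense as `ν` charges open sets, and continuity in `v` does the rest.
  have hdense : Dense {v | AEStronglyMeasurable (fun x => χ x v) μ} :=
    Measure.dense_of_ae (μ := ν) hχ.prod_swap.prodMk_left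
  obtain ⟨t, hts, htc, htd⟩ := hdense.exists_countable_dense_subset
  obtain ⟨e, rfl⟩ := htc.exists_eq_range htd.nonempty
  have hmeas (k : ℕ) : AEStronglyMeasurable (fun x => χ x (e k)) μ := hts ⟨k, rfl⟩
  obtain ⟨w', hw', hww'⟩ := hw
  have hwm : Measurable w' := hw'.measurable
  refine aestronglyMeasurable_of_tendsto_ae atTop
    (f := fun N x => χ x (SimpleFunc.nearestPt e N (w' x))) (fun N => ?_) ?_
  -- The approximation of `w'` takes values in the sequence `e`; on the piece where its index is
  -- `k`, the composition is the measurable section `χ(·, e k)`.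
  · have huniv : ⋃ k, {x | SimpleFunc.nearestPtInd e N (w' x) = k} = Set.univ := by
      ext x; simp
    rw [← Measure.restrict_univ (μ := μ), ← huniv, aestronglyMeasurable_iUnion_iff]
    intro k
    refine ((hmeas k).restrict).congr ?_
    have hk : MeasurableSet {x | SimpleFunc.nearestPtInd e N (w' x) = k} :=
      ((SimpleFunc.nearestPtInd e N).measurable.comp hwm) (measurableSet_singleton k)
    filter_upwards [ae_restrict_mem hk] with x hx
    simp only [SimpleFunc.nearestPt, SimpleFunc.map_apply]
    rw [show SimpleFunc.nearestPtInd e N (w' x) = k from hx]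
  · filter_upwards [hc, hww'] with x hx hxw
    have h1 : Tendsto (fun N => SimpleFunc.nearestPt e N (w' x)) atTop (𝓝 (w' x)) :=
      SimpleFunc.tendsto_nearestPt (htd _)
    rw [hxw]
    exact (hx.tendsto _).comp h1

variable {d : ℕ} {Ω : Set (EuclideanSpace ℝ (Fin d))} {s κ : ℝ}
  {χ : EuclideanSpace ℝ (Fin d) → EuclideanSpace ℝ (Fin d) → EuclideanSpace ℝ (Fin d)}

theorem IsConvectionLaw.continuous_ae (hs : 1 < s) (hχ : IsConvectionLaw Ω s κ χ) :
    ∀ᵐ x ∂(volume.restrict Ω), Continuous (χ x) := by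
  filter_upwards [hχ.holder] with x hx
  have hσ : 0 < min s 2 - 1 := sub_pos.2 (lt_min hs one_lt_two)
  have hθ : 0 ≤ (s - min s 2) / s := div_nonneg (sub_nonneg.2 (min_le_left _ _)) (by linarith)
  refine continuous_iff_continuousAt.2 fun v => ?_
  refine tendsto_iff_norm_sub_tendsto_zero.2 (squeeze_zero (fun _ => norm_nonneg _)
    (fun w => hx v w) ?_)
  have hcont : Continuous fun w : EuclideanSpace ℝ (Fin d) =>
      κ * (‖w‖ ^ s + ‖v‖ ^ s) ^ ((s - min s 2) / s) * ‖w - v‖ ^ (min s 2 - 1) := by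
    refine (continuous_const.mul (Continuous.rpow_const ?_ fun _ => Or.inr hθ)).mul
      (Continuous.rpow_const (by fun_prop) fun _ => Or.inr hσ.le)
    exact (continuous_norm.rpow_const fun _ => Or.inr (by linarith)).add continuous_const
  simpa [Real.zero_rpow hσ.ne'] using hcont.tendsto v

theorem IsConvectionLaw.aestronglyMeasurable_comp (hs : 1 < s) (hχ : IsConvectionLaw Ω s κ χ)
    {w : EuclideanSpace ℝ (Fin d) → EuclideanSpace ℝ (Fin d)}
    (hw : AEStronglyMeasurable w (volume.restrict Ω)) :
    AEStronglyMeasurable (fun x => χ x (w x)) (volume.restrict Ω) :=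
  aestronglyMeasurable_superposition hχ.measurable.aestronglyMeasurable (hχ.continuous_ae hs) hw

end Caratheodory

/-! ### Linearity of the advection form in each argument. -/

section Advection

variable {d : ℕ}

theorem advection_sub_left (b c : EuclideanSpace ℝ (Fin d)) (A : Matrix (Fin d) (Fin d) ℝ)
    (z : EuclideanSpace ℝ (Fin d)) :
    advection (b - c) A z = advection b A z - advection c A z := by
  simp [advection, sub_mul, Finset.sum_sub_distrib]

theorem advection_sub_matrix (b : EuclideanSpace ℝ (Fin d)) (A B : Matrix (Fin d) (Fin d) ℝ)
    (z : EuclideanSpace ℝ (Fin d)) :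
    advection b (A - B) z = advection b A z - advection b B z := by
  simp [advection, mul_sub, sub_mul, Finset.sum_sub_distrib]

theorem advection_sub_right (b : EuclideanSpace ℝ (Fin d)) (A : Matrix (Fin d) (Fin d) ℝ)
    (y z : EuclideanSpace ℝ (Fin d)) :
    advection b A (y - z) = advection b A y - advection b A z := by
  simp [advection, mul_sub, Finset.sum_sub_distrib]

theorem advection_smul_right (b : EuclideanSpace ℝ (Fin d)) (A : Matrix (Fin d) (Fin d) ℝ)
    (a : ℝ) (z : EuclideanSpace ℝ (Fin d)) :
    advection b A (a • z) = a * advection b A z := by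
  simp only [advection, PiLp.smul_apply, smul_eq_mul, Finset.mul_sum]
  exact Finset.sum_congr rfl fun i _ => Finset.sum_congr rfl fun j _ => by ring

end Advection

/-! ### Hölder continuity of the projection on a moving line. -/

section Projection

variable {E : Type*} [NormedAddCommGroup E] [InnerProductSpace ℝ E]

/-- The projection of `z` on the line spanned by `w`, equal to `0` if `w = 0`. -/
noncomputable def lineProj (w z : E) : E := (inner ℝ z w / ‖w‖ ^ 2) • w

theorem lineProj_eq (w z : E) :
    lineProj w z = inner ℝ z (‖w‖⁻¹ • w) • (‖w‖⁻¹ • w) := by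
  rw [lineProj, inner_smul_right, smul_smul]
  congr 1
  ring

theorem norm_inv_norm_smul_le (w : E) : ‖‖w‖⁻¹ • w‖ ≤ 1 := by
  rw [norm_smul, norm_inv, norm_norm]
  exact inv_mul_le_one

theorem norm_lineProj_le (w z : E) : ‖lineProj w z‖ ≤ ‖z‖ := by
  rw [lineProj_eq, norm_smul]
  have h := norm_inv_norm_smul_le w
  calc _ ≤ (‖z‖ * ‖‖w‖⁻¹ • w‖) * ‖‖w‖⁻¹ • w‖ := by gcongr; exact norm_inner_le_norm _ _
    _ ≤ (‖z‖ * 1) * 1 := by gcongr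
    _ = ‖z‖ := by ring

/-- Rests on `|w| û - w = (|w| - |u|) û + (u - w)` with `û = u / |u|`. Zero vectors are covered,
since then `û = 0`. -/
theorem norm_mul_norm_normalize_sub_le (u w : E) :
    ‖w‖ * ‖‖u‖⁻¹ • u - ‖w‖⁻¹ • w‖ ≤ 2 * ‖u - w‖ := by
  have h1 : ‖w‖ * ‖‖u‖⁻¹ • u - ‖w‖⁻¹ • w‖ = ‖‖w‖ • (‖u‖⁻¹ • u) - w‖ := by
    rcases eq_or_ne w 0 with rfl | hw
    · simp
    · rw [← norm_norm w, ← norm_smul, norm_norm, smul_sub, smul_inv_smul₀ (norm_ne_zero_iff.2 hw)]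
  have h2 : ‖u‖ • (‖u‖⁻¹ • u) = u := by
    rcases eq_or_ne u 0 with rfl | hu
    · simp
    · exact smul_inv_smul₀ (norm_ne_zero_iff.2 hu) u
  have h3 : ‖w‖ • (‖u‖⁻¹ • u) - w = (‖w‖ - ‖u‖) • (‖u‖⁻¹ • u) + (u - w) := by
    rw [sub_smul, h2]; abel
  rw [h1, h3]
  calc _ ≤ |‖w‖ - ‖u‖| * ‖‖u‖⁻¹ • u‖ + ‖u - w‖ := by
        refine (norm_add_le _ _).trans_eq ?_
        rw [norm_smul, Real.norm_eq_abs]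
    _ ≤ ‖u - w‖ * 1 + ‖u - w‖ := by
        gcongr
        · rw [norm_sub_rev]; exact abs_norm_sub_norm_le _ _
        · exact norm_inv_norm_smul_le u
    _ = 2 * ‖u - w‖ := by ring

/-- The projection is quadratic in the unit vector, so the normalization estimate is used once in
each factor. -/
theorem norm_mul_norm_lineProj_sub_le (u w z : E) :
    ‖w‖ * ‖lineProj u z - lineProj w z‖ ≤ 4 * (‖u - w‖ * ‖z‖) := by
  set a := ‖u‖⁻¹ • u with ha
  set b := ‖w‖⁻¹ • w with hb
  have h1 : lineProj u z - lineProj w z = inner ℝ z a • (a - b) + inner ℝ z (a - b) • b := by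
    rw [lineProj_eq, lineProj_eq, inner_sub_right, smul_sub, sub_smul]
    abel
  have h2 : ‖lineProj u z - lineProj w z‖ ≤ 2 * (‖z‖ * ‖a - b‖) := by
    rw [h1]
    calc _ ≤ ‖inner ℝ z a‖ * ‖a - b‖ + ‖inner ℝ z (a - b)‖ * ‖b‖ := by
          refine (norm_add_le _ _).trans_eq ?_
          rw [norm_smul, norm_smul]
      _ ≤ (‖z‖ * 1) * ‖a - b‖ + (‖z‖ * ‖a - b‖) * 1 := by
          gcongr
          · exact (norm_inner_le_norm _ _).trans (by gcongr; exact norm_inv_norm_smul_le u)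
          · exact norm_inner_le_norm _ _
          · exact norm_inv_norm_smul_le w
      _ = _ := by ring
  calc _ ≤ ‖w‖ * (2 * (‖z‖ * ‖a - b‖)) := by gcongr
    _ = 2 * ‖z‖ * (‖w‖ * ‖a - b‖) := by ring
    _ ≤ 2 * ‖z‖ * (2 * ‖u - w‖) :=
        mul_le_mul_of_nonneg_left (norm_mul_norm_normalize_sub_le u w) (by positivity)
    _ = _ := by ring

/-- Interpolation: with `D` the norm of the difference, the Lipschitz bound on `‖w‖ * D` is raised
to the power `t - 1` and the trivial bound on `D` to the power `2 - t`. -/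
theorem norm_rpow_mul_norm_lineProj_sub_le {s t : ℝ} (ht : 1 ≤ t) (ht2 : t ≤ 2) (hts : t ≤ s)
    (u w z : E) :
    ‖w‖ ^ (s - 1) * ‖lineProj u z - lineProj w z‖ ≤
      4 * ((‖u‖ + ‖w‖) ^ (s - t) * ‖u - w‖ ^ (t - 1) * ‖z‖) := by
  set D := ‖lineProj u z - lineProj w z‖ with hD
  have hD0 : 0 ≤ D := norm_nonneg _
  -- The constant `2` would do; `4` matches the Lipschitz bound, so that the powers of `4 * ‖z‖`
  -- recombine.
  have h1 : D ≤ 4 * ‖z‖ := by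
    refine (norm_sub_le _ _).trans ?_
    linarith [norm_lineProj_le u z, norm_lineProj_le w z, norm_nonneg z]
  have h2 : ‖w‖ * D ≤ 4 * (‖u - w‖ * ‖z‖) := norm_mul_norm_lineProj_sub_le u w z
  have split {a : ℝ} (ha : 0 ≤ a) : a = a ^ (t - 1) * a ^ (2 - t) := by
    rw [← Real.rpow_add_of_nonneg ha (by linarith) (by linarith)]
    simp [show t - 1 + (2 - t) = 1 by ring]
  have hw : ‖w‖ ^ (s - 1) = ‖w‖ ^ (s - t) * ‖w‖ ^ (t - 1) := by
    rw [← Real.rpow_add_of_nonneg (norm_nonneg w) (by linarith) (by linarith)]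
    congr 1; ring
  calc ‖w‖ ^ (s - 1) * D = ‖w‖ ^ (s - t) * (‖w‖ * D) ^ (t - 1) * D ^ (2 - t) := by
        rw [Real.mul_rpow (norm_nonneg w) hD0, hw]
        conv_lhs => rw [split hD0]
        ring
    _ ≤ (‖u‖ + ‖w‖) ^ (s - t) * (4 * (‖u - w‖ * ‖z‖)) ^ (t - 1) * (4 * ‖z‖) ^ (2 - t) := by
        gcongr
        · exact le_add_of_nonneg_left (norm_nonneg u)
    _ = (‖u‖ + ‖w‖) ^ (s - t) * ‖u - w‖ ^ (t - 1) *
          ((4 * ‖z‖) ^ (t - 1) * (4 * ‖z‖) ^ (2 - t)) := by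
        rw [show 4 * (‖u - w‖ * ‖z‖) = ‖u - w‖ * (4 * ‖z‖) by ring,
          Real.mul_rpow (norm_nonneg _) (by positivity)]
        ring
    _ = _ := by rw [← split (by positivity)]; ring

end Projection

/-! ### Growth and continuity of the convection law. -/

section Holder

variable {d : ℕ} {s κ : ℝ} {f : EuclideanSpace ℝ (Fin d) → EuclideanSpace ℝ (Fin d)}

/-- Superadditivity of `x ↦ x ^ s` replaces the sum of powers by a power of `‖u‖ + ‖w‖`. -/
theorem norm_sub_le_of_holder (hs : 1 < s) (hκ : 0 ≤ κ)
    (hf : ∀ v w : EuclideanSpace ℝ (Fin d), ‖f w - f v‖ ≤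
      κ * (‖w‖ ^ s + ‖v‖ ^ s) ^ ((s - min s 2) / s) * ‖w - v‖ ^ (min s 2 - 1))
    (u w : EuclideanSpace ℝ (Fin d)) :
    ‖f u - f w‖ ≤ κ * ((‖u‖ + ‖w‖) ^ (s - min s 2) * ‖u - w‖ ^ (min s 2 - 1)) := by
  refine (hf w u).trans ?_
  have hθ : 0 ≤ (s - min s 2) / s := div_nonneg (sub_nonneg.2 (min_le_left _ _)) (by linarith)
  rw [mul_assoc]
  gcongr
  calc (‖u‖ ^ s + ‖w‖ ^ s) ^ ((s - min s 2) / s)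
      ≤ ((‖u‖ + ‖w‖) ^ s) ^ ((s - min s 2) / s) := by
        gcongr
        exact Real.add_rpow_le_rpow_add (norm_nonneg _) (norm_nonneg _) hs.le
    _ = (‖u‖ + ‖w‖) ^ (s - min s 2) := by
        rw [← Real.rpow_mul (by positivity), mul_div_cancel₀ _ (by linarith)]

theorem norm_le_of_holder (hs : 1 < s) (hκ : 0 ≤ κ) (h0 : f 0 = 0)
    (hf : ∀ v w : EuclideanSpace ℝ (Fin d), ‖f w - f v‖ ≤
      κ * (‖w‖ ^ s + ‖v‖ ^ s) ^ ((s - min s 2) / s) * ‖w - v‖ ^ (min s 2 - 1))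
    (w : EuclideanSpace ℝ (Fin d)) : ‖f w‖ ≤ κ * ‖w‖ ^ (s - 1) := by
  have h := norm_sub_le_of_holder hs hκ hf w 0
  rw [h0, sub_zero, sub_zero, norm_zero, add_zero, ← Real.rpow_add_of_nonneg (norm_nonneg w)
    (sub_nonneg.2 (min_le_left _ _)) (sub_nonneg.2 (le_min hs.le one_le_two))] at h
  convert h using 3
  ring

end Holder

/-! ### Pointwise bounds on differences of the integrands. -/

section Pointwise

variable {d : ℕ} {s κ : ℝ} {f : EuclideanSpace ℝ (Fin d) → EuclideanSpace ℝ (Fin d)}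

theorem inner_div_mul_advection (b w z : EuclideanSpace ℝ (Fin d))
    (A : Matrix (Fin d) (Fin d) ℝ) :
    inner ℝ z w / ‖w‖ ^ 2 * advection b A w = advection b A (lineProj w z) :=
  (advection_smul_right b A _ w).symm

theorem abs_advection_le_of_holder (hs : 1 < s) (hκ : 0 ≤ κ) (h0 : f 0 = 0)
    (hf : ∀ v w : EuclideanSpace ℝ (Fin d), ‖f w - f v‖ ≤
      κ * (‖w‖ ^ s + ‖v‖ ^ s) ^ ((s - min s 2) / s) * ‖w - v‖ ^ (min s 2 - 1))
    (w z : EuclideanSpace ℝ (Fin d)) (A : Matrix (Fin d) (Fin d) ℝ) :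
    |advection (f w) A z| ≤ κ * (‖w‖ ^ (s - 1) * ‖z‖ * frobeniusNorm A) := by
  refine (abs_advection_le _ _ _).trans ?_
  have hA := frobeniusNorm_nonneg A
  calc ‖f w‖ * frobeniusNorm A * ‖z‖ ≤ (κ * ‖w‖ ^ (s - 1)) * frobeniusNorm A * ‖z‖ := by
        gcongr; exact norm_le_of_holder hs hκ h0 hf w
    _ = _ := by ring

theorem abs_advection_sub_left_le_of_holder (hs : 1 < s) (hκ : 0 ≤ κ)
    (hf : ∀ v w : EuclideanSpace ℝ (Fin d), ‖f w - f v‖ ≤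
      κ * (‖w‖ ^ s + ‖v‖ ^ s) ^ ((s - min s 2) / s) * ‖w - v‖ ^ (min s 2 - 1))
    (u w z : EuclideanSpace ℝ (Fin d)) (A : Matrix (Fin d) (Fin d) ℝ) :
    |advection (f u - f w) A z| ≤
      κ * ((‖u‖ + ‖w‖) ^ (s - min s 2) * ‖u - w‖ ^ (min s 2 - 1) * ‖z‖ * frobeniusNorm A) := by
  refine (abs_advection_le _ _ _).trans ?_
  have hA := frobeniusNorm_nonneg A
  calc _ ≤ (κ * ((‖u‖ + ‖w‖) ^ (s - min s 2) * ‖u - w‖ ^ (min s 2 - 1))) *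
        frobeniusNorm A * ‖z‖ := by
        gcongr; exact norm_sub_le_of_holder hs hκ hf u w
    _ = _ := by ring

theorem abs_advection_sub_le_of_holder (hs : 1 < s) (hκ : 0 ≤ κ) (h0 : f 0 = 0)
    (hf : ∀ v w : EuclideanSpace ℝ (Fin d), ‖f w - f v‖ ≤
      κ * (‖w‖ ^ s + ‖v‖ ^ s) ^ ((s - min s 2) / s) * ‖w - v‖ ^ (min s 2 - 1))
    (u w z : EuclideanSpace ℝ (Fin d)) (A B : Matrix (Fin d) (Fin d) ℝ) :
    |advection (f u) A z - advection (f w) B z| ≤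
      κ * ((‖u‖ + ‖w‖) ^ (s - min s 2) * ‖u - w‖ ^ (min s 2 - 1) * ‖z‖ * frobeniusNorm A) +
      κ * ((‖u‖ + ‖w‖) ^ (s - 1) * ‖z‖ * frobeniusNorm (A - B)) := by
  have e : advection (f u) A z - advection (f w) B z =
      advection (f u - f w) A z + advection (f w) (A - B) z := by
    rw [advection_sub_left, advection_sub_matrix]; ring
  rw [e]
  refine (abs_add_le _ _).trans (add_le_add
    (abs_advection_sub_left_le_of_holder hs hκ hf u w z A) ?_)
  refine (abs_advection_le_of_holder hs hκ h0 hf w z (A - B)).trans ?_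
  have hA := frobeniusNorm_nonneg (A - B)
  gcongr
  exact le_add_of_nonneg_left (norm_nonneg u)

/-- Telescoping over law, projection and matrix. Moving the projection leaves the factor `f w`,
whose growth `‖w‖ ^ (s - 1)` pays for the singularity at `w = 0`. The constant is `5 = 1 + 4`. -/
theorem abs_advection_lineProj_sub_le_of_holder (hs : 1 < s) (hκ : 0 ≤ κ) (h0 : f 0 = 0)
    (hf : ∀ v w : EuclideanSpace ℝ (Fin d), ‖f w - f v‖ ≤
      κ * (‖w‖ ^ s + ‖v‖ ^ s) ^ ((s - min s 2) / s) * ‖w - v‖ ^ (min s 2 - 1))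
    (u w z : EuclideanSpace ℝ (Fin d)) (A B : Matrix (Fin d) (Fin d) ℝ) :
    |advection (f u) A (lineProj u z) - advection (f w) B (lineProj w z)| ≤
      5 * (κ * ((‖u‖ + ‖w‖) ^ (s - min s 2) * ‖u - w‖ ^ (min s 2 - 1) * ‖z‖ *
        frobeniusNorm A)) +
      κ * ((‖u‖ + ‖w‖) ^ (s - 1) * ‖z‖ * frobeniusNorm (A - B)) := by
  have e : advection (f u) A (lineProj u z) - advection (f w) B (lineProj w z) =
      advection (f u - f w) A (lineProj u z) + advection (f w) A (lineProj u z - lineProj w z) +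
        advection (f w) (A - B) (lineProj w z) := by
    rw [advection_sub_left, advection_sub_matrix, advection_sub_right]; ring
  have hA := frobeniusNorm_nonneg A
  have hAB := frobeniusNorm_nonneg (A - B)
  have h1 : |advection (f u - f w) A (lineProj u z)| ≤
      κ * ((‖u‖ + ‖w‖) ^ (s - min s 2) * ‖u - w‖ ^ (min s 2 - 1) * ‖z‖ * frobeniusNorm A) := by
    refine (abs_advection_sub_left_le_of_holder hs hκ hf u w _ A).trans ?_
    gcongr
    exact norm_lineProj_le u z
  have h2 : |advection (f w) A (lineProj u z - lineProj w z)| ≤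
      4 * (κ * ((‖u‖ + ‖w‖) ^ (s - min s 2) * ‖u - w‖ ^ (min s 2 - 1) * ‖z‖ *
        frobeniusNorm A)) := by
    refine (abs_advection_le_of_holder hs hκ h0 hf w _ A).trans ?_
    calc _ ≤ κ * (4 * ((‖u‖ + ‖w‖) ^ (s - min s 2) * ‖u - w‖ ^ (min s 2 - 1) * ‖z‖) *
          frobeniusNorm A) := by
          refine mul_le_mul_of_nonneg_left (mul_le_mul_of_nonneg_right ?_ hA) hκ
          exact norm_rpow_mul_norm_lineProj_sub_le (le_min hs.le one_le_two) (min_le_right _ _)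
            (min_le_left _ _) u w z
      _ = _ := by ring
  have h3 : |advection (f w) (A - B) (lineProj w z)| ≤
      κ * ((‖u‖ + ‖w‖) ^ (s - 1) * ‖z‖ * frobeniusNorm (A - B)) := by
    refine (abs_advection_le_of_holder hs hκ h0 hf w _ (A - B)).trans ?_
    gcongr
    · exact le_add_of_nonneg_left (norm_nonneg u)
    · exact norm_lineProj_le w z
  rw [e]
  linarith [abs_add_three (advection (f u - f w) A (lineProj u z))
    (advection (f w) A (lineProj u z - lineProj w z)) (advection (f w) (A - B) (lineProj w z))]

theorem abs_advection_self_sub_le_of_holder (hs : 1 < s) (hκ : 0 ≤ κ) (h0 : f 0 = 0)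
    (hf : ∀ v w : EuclideanSpace ℝ (Fin d), ‖f w - f v‖ ≤
      κ * (‖w‖ ^ s + ‖v‖ ^ s) ^ ((s - min s 2) / s) * ‖w - v‖ ^ (min s 2 - 1))
    (u w : EuclideanSpace ℝ (Fin d)) (G : Matrix (Fin d) (Fin d) ℝ) :
    |advection (f u) G u - advection (f w) G w| ≤
      2 * (κ * ((‖u‖ + ‖w‖) ^ (s + 1 - min s 2) * ‖u - w‖ ^ (min s 2 - 1) *
        frobeniusNorm G)) := by
  have ht1 : 1 < min s 2 := lt_min hs one_lt_two
  have ht2 : min s 2 ≤ 2 := min_le_right _ _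
  have hts : min s 2 ≤ s := min_le_left _ _
  have e : advection (f u) G u - advection (f w) G w =
      advection (f u - f w) G u + advection (f w) G (u - w) := by
    rw [advection_sub_left, advection_sub_right]; ring
  have hG := frobeniusNorm_nonneg G
  set N := ‖u‖ + ‖w‖ with hN
  have hN0 : 0 ≤ N := by positivity
  have hu : ‖u‖ ≤ N := le_add_of_nonneg_right (norm_nonneg w)
  have hw : ‖w‖ ≤ N := le_add_of_nonneg_left (norm_nonneg u)
  have hsplit : N ^ (s - min s 2) * N = N ^ (s + 1 - min s 2) := by
    rw [show s + 1 - min s 2 = s - min s 2 + 1 by ring,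
      Real.rpow_add_of_nonneg hN0 (by linarith) zero_le_one, Real.rpow_one]
  have h1 : |advection (f u - f w) G u| ≤
      κ * (N ^ (s + 1 - min s 2) * ‖u - w‖ ^ (min s 2 - 1) * frobeniusNorm G) := by
    refine (abs_advection_sub_left_le_of_holder hs hκ hf u w u G).trans ?_
    calc _ ≤ κ * (N ^ (s - min s 2) * ‖u - w‖ ^ (min s 2 - 1) * N * frobeniusNorm G) := by
          gcongr
      _ = _ := by rw [← hsplit]; ring
  have h2 : |advection (f w) G (u - w)| ≤
      κ * (N ^ (s + 1 - min s 2) * ‖u - w‖ ^ (min s 2 - 1) * frobeniusNorm G) := by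
    refine (abs_advection_le_of_holder hs hκ h0 hf w (u - w) G).trans ?_
    -- The Lipschitz factor is too strong: the excess power `2 - min s 2` is traded for a power of
    -- `N`.
    have he : ‖u - w‖ = ‖u - w‖ ^ (2 - min s 2) * ‖u - w‖ ^ (min s 2 - 1) := by
      rw [← Real.rpow_add_of_nonneg (norm_nonneg _) (by linarith) (by linarith)]
      simp [show 2 - min s 2 + (min s 2 - 1) = 1 by ring]
    have hsplit2 : N ^ (s - 1) * N ^ (2 - min s 2) = N ^ (s + 1 - min s 2) := by
      rw [← Real.rpow_add_of_nonneg hN0 (by linarith) (by linarith)]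
      congr 1; ring
    calc _ = κ * (‖w‖ ^ (s - 1) * (‖u - w‖ ^ (2 - min s 2) * ‖u - w‖ ^ (min s 2 - 1)) *
            frobeniusNorm G) := by rw [← he]
      _ ≤ κ * (N ^ (s - 1) * (N ^ (2 - min s 2) * ‖u - w‖ ^ (min s 2 - 1)) *
            frobeniusNorm G) := by
          gcongr
          exact norm_sub_le u w
      _ = _ := by rw [← hsplit2]; ring
  rw [e]
  linarith [abs_add_le (advection (f u - f w) G u) (advection (f w) G (u - w))]

theorem abs_convective_integrand_sub_le (hs : 1 < s) (hκ : 0 ≤ κ) (h0 : f 0 = 0)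
    (hf : ∀ v w : EuclideanSpace ℝ (Fin d), ‖f w - f v‖ ≤
      κ * (‖w‖ ^ s + ‖v‖ ^ s) ^ ((s - min s 2) / s) * ‖w - v‖ ^ (min s 2 - 1))
    (u w z : EuclideanSpace ℝ (Fin d)) (A B G : Matrix (Fin d) (Fin d) ℝ) :
    |(1 / s * advection (f u) A z +
        (s - 2) / s * (inner ℝ z u / ‖u‖ ^ 2 * advection (f u) A u) -
        1 / (s / (s - 1)) * advection (f u) G u) -
      (1 / s * advection (f w) B z +
        (s - 2) / s * (inner ℝ z w / ‖w‖ ^ 2 * advection (f w) B w) -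
        1 / (s / (s - 1)) * advection (f w) G w)| ≤
      6 * κ * ((‖u‖ + ‖w‖) ^ (s - min s 2) * ‖u - w‖ ^ (min s 2 - 1) * ‖z‖ * frobeniusNorm A +
        (‖u‖ + ‖w‖) ^ (s - 1) * ‖z‖ * frobeniusNorm (A - B) +
        (‖u‖ + ‖w‖) ^ (s + 1 - min s 2) * ‖u - w‖ ^ (min s 2 - 1) * frobeniusNorm G) := by
  have h1 := abs_advection_sub_le_of_holder hs hκ h0 hf u w z A B
  have h2 := abs_advection_lineProj_sub_le_of_holder hs hκ h0 hf u w z A B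
  have h3 := abs_advection_self_sub_le_of_holder hs hκ h0 hf u w G
  rw [inner_div_mul_advection, inner_div_mul_advection]
  have hs0 : 0 < s := by linarith
  have c1 : |1 / s| ≤ 1 := by
    rw [abs_of_pos (by positivity), div_le_one hs0]; exact hs.le
  have c2 : |(s - 2) / s| ≤ 1 := by
    rw [abs_div, abs_of_pos hs0, div_le_one hs0, abs_le]
    constructor <;> linarith
  have c3 : |1 / (s / (s - 1))| ≤ 1 := by
    rw [one_div_div, abs_of_nonneg (div_nonneg (by linarith) hs0.le), div_le_one hs0]
    linarith
  have hmul {c a : ℝ} (hc : |c| ≤ 1) : |c * a| ≤ |a| := by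
    rw [abs_mul]; exact mul_le_of_le_one_left (abs_nonneg a) hc
  set I₁ := advection (f u) A z - advection (f w) B z with hI1
  set I₂ := advection (f u) A (lineProj u z) - advection (f w) B (lineProj w z) with hI2
  set I₃ := advection (f u) G u - advection (f w) G w with hI3
  have hA := frobeniusNorm_nonneg A
  have hAB := frobeniusNorm_nonneg (A - B)
  have hG := frobeniusNorm_nonneg G
  set T₁ := (‖u‖ + ‖w‖) ^ (s - min s 2) * ‖u - w‖ ^ (min s 2 - 1) * ‖z‖ * frobeniusNorm A
  set T₂ := (‖u‖ + ‖w‖) ^ (s - 1) * ‖z‖ * frobeniusNorm (A - B)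
  set T₃ := (‖u‖ + ‖w‖) ^ (s + 1 - min s 2) * ‖u - w‖ ^ (min s 2 - 1) * frobeniusNorm G
  have p2 : 0 ≤ κ * T₂ := by positivity
  have p3 : 0 ≤ κ * T₃ := by positivity
  calc _ = |1 / s * I₁ + (s - 2) / s * I₂ + -(1 / (s / (s - 1)) * I₃)| := by
        congr 1; rw [hI1, hI2, hI3]; ring
    _ ≤ |1 / s * I₁| + |(s - 2) / s * I₂| + |-(1 / (s / (s - 1)) * I₃)| := abs_add_three _ _ _
    _ ≤ |I₁| + |I₂| + |I₃| := by
        rw [abs_neg]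
        exact add_le_add (add_le_add (hmul c1) (hmul c2)) (hmul c3)
    -- `T₁` occurs `1 + 5` times, `T₂` and `T₃` twice each; `p2` and `p3` allow rounding up to `6`.
    _ ≤ 6 * κ * (T₁ + T₂ + T₃) := by linarith

end Pointwise

/-! ### Hölder's inequality with four weighted factors. -/

section HolderInequality

variable {α F₁ F₂ F₃ F₄ : Type*} [MeasurableSpace α] {μ : Measure α} [NormedAddCommGroup F₁]
  [NormedAddCommGroup F₂] [NormedAddCommGroup F₃] [NormedAddCommGroup F₄]

/-- Hölder with weights `a / q`, `b / q`, `c / q`, `1 / m`. Vanishing exponents are allowed, so that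
one statement serves all the terms of the estimate. -/
theorem lintegral_enorm_rpow_mul_le {f : α → F₁} {g : α → F₂} {h : α → F₃} {k : α → F₄}
    (hf : AEStronglyMeasurable f μ) (hg : AEStronglyMeasurable g μ)
    (hh : AEStronglyMeasurable h μ) (hk : AEStronglyMeasurable k μ)
    {a b c q m : ℝ} (ha : 0 ≤ a) (hb : 0 ≤ b) (hc : 0 ≤ c) (hq : 0 < q) (hm : 0 < m)
    (hsum : (a + b + c) / q + 1 / m = 1) :
    ∫⁻ x, ‖f x‖ₑ ^ a * ‖g x‖ₑ ^ b * ‖h x‖ₑ ^ c * ‖k x‖ₑ ∂μ ≤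
      eLpNorm f (ENNReal.ofReal q) μ ^ a * eLpNorm g (ENNReal.ofReal q) μ ^ b *
        eLpNorm h (ENNReal.ofReal q) μ ^ c * eLpNorm k (ENNReal.ofReal m) μ := by
  have key := ENNReal.lintegral_prod_norm_pow_le (μ := μ) Finset.univ
    (f := ![fun x => ‖f x‖ₑ ^ q, fun x => ‖g x‖ₑ ^ q, fun x => ‖h x‖ₑ ^ q, fun x => ‖k x‖ₑ ^ m])
    (p := ![a / q, b / q, c / q, 1 / m]) ?_ ?_ ?_
  · have e1 (y : ℝ≥0∞) (b : ℝ) : (y ^ q) ^ (b / q) = y ^ b := by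
      rw [← ENNReal.rpow_mul, mul_div_cancel₀ _ hq.ne']
    have e2 (y : ℝ≥0∞) : (y ^ m) ^ (1 / m) = y := by
      rw [← ENNReal.rpow_mul, mul_one_div_cancel hm.ne', ENNReal.rpow_one]
    have e3 (y : ℝ≥0∞) (b : ℝ) : (y ^ (1 / q)) ^ b = y ^ (b / q) := by
      rw [← ENNReal.rpow_mul]; congr 1; ring
    simp only [Fin.prod_univ_four, Matrix.cons_val, e1, e2] at key
    simpa only [eLpNorm_eq_lintegral_rpow_enorm_toReal (ENNReal.ofReal_pos.2 hq).ne'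
      ENNReal.ofReal_ne_top, eLpNorm_eq_lintegral_rpow_enorm_toReal (ENNReal.ofReal_pos.2 hm).ne'
      ENNReal.ofReal_ne_top, ENNReal.toReal_ofReal hq.le, ENNReal.toReal_ofReal hm.le, e3]
      using key
  · intro i _
    fin_cases i
    · exact hf.enorm.pow_const q
    · exact hg.enorm.pow_const q
    · exact hh.enorm.pow_const q
    · exact hk.enorm.pow_const m
  · rw [Fin.sum_univ_four]
    simpa [add_div] using hsum
  · intro i _
    fin_cases i
    · exact div_nonneg ha hq.le
    · exact div_nonneg hb hq.le
    · exact div_nonneg hc hq.le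
    · exact one_div_nonneg.2 hm.le

theorem lintegral_enorm_rpow_mul_le_of_eLpNorm_le {f : α → F₁} {g : α → F₂} {h : α → F₃}
    {k : α → F₄} (hf : AEStronglyMeasurable f μ) (hg : AEStronglyMeasurable g μ)
    (hh : AEStronglyMeasurable h μ) (hk : AEStronglyMeasurable k μ)
    {a b c q m : ℝ} (ha : 0 ≤ a) (hb : 0 ≤ b) (hc : 0 ≤ c) (hq : 0 < q) (hm : 0 < m)
    (hsum : (a + b + c) / q + 1 / m = 1) {C Y Z V : ℝ≥0∞}
    (hY : eLpNorm f (ENNReal.ofReal q) μ ≤ C * Y) (hZ : eLpNorm g (ENNReal.ofReal q) μ ≤ C * Z)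
    (hV : eLpNorm h (ENNReal.ofReal q) μ ≤ C * V) :
    ∫⁻ x, ‖f x‖ₑ ^ a * ‖g x‖ₑ ^ b * ‖h x‖ₑ ^ c * ‖k x‖ₑ ∂μ ≤
      C ^ (a + b + c) * (Y ^ a * Z ^ b * V ^ c * eLpNorm k (ENNReal.ofReal m) μ) := by
  refine (lintegral_enorm_rpow_mul_le hf hg hh hk ha hb hc hq hm hsum).trans ?_
  calc _ ≤ (C * Y) ^ a * (C * Z) ^ b * (C * V) ^ c * eLpNorm k (ENNReal.ofReal m) μ := by
        gcongr
    _ = _ := by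
        rw [ENNReal.mul_rpow_of_nonneg _ _ ha, ENNReal.mul_rpow_of_nonneg _ _ hb,
          ENNReal.mul_rpow_of_nonneg _ _ hc, ENNReal.rpow_add_of_nonneg _ _ (by positivity) hc,
          ENNReal.rpow_add_of_nonneg _ _ ha hb]
        ring

end HolderInequality

/-! ### Measurability and absolute convergence of the three integrals. -/

section ConvectiveIntegrals

variable {d : ℕ} {Ω : Set (EuclideanSpace ℝ (Fin d))} {s κ r m q : ℝ}
  {χ : EuclideanSpace ℝ (Fin d) → EuclideanSpace ℝ (Fin d) → EuclideanSpace ℝ (Fin d)}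
  {u v w : EuclideanSpace ℝ (Fin d) → EuclideanSpace ℝ (Fin d)} {p : ℝ≥0∞}

theorem AEStronglyMeasurable.advection {b z : EuclideanSpace ℝ (Fin d) → EuclideanSpace ℝ (Fin d)}
    {A : EuclideanSpace ℝ (Fin d) → Matrix (Fin d) (Fin d) ℝ}
    {μ : Measure (EuclideanSpace ℝ (Fin d))}
    (hb : AEStronglyMeasurable b μ) (hA : ∀ i j, AEStronglyMeasurable (fun x => A x i j) μ)
    (hz : AEStronglyMeasurable z μ) :
    AEStronglyMeasurable (fun x => _root_.advection (b x) (A x) (z x)) μ := by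
  unfold _root_.advection
  have hc {y : EuclideanSpace ℝ (Fin d) → EuclideanSpace ℝ (Fin d)}
      (hy : AEStronglyMeasurable y μ) (i : Fin d) : AEStronglyMeasurable (fun x => y x i) μ :=
    (EuclideanSpace.proj (𝕜 := ℝ) i).continuous.comp_aestronglyMeasurable hy
  exact Finset.aestronglyMeasurable_fun_sum _ fun i _ =>
    Finset.aestronglyMeasurable_fun_sum _ fun j _ => ((hc hb j).mul (hA i j)).mul (hc hz i)

theorem AEStronglyMeasurable.lineProj {z w : EuclideanSpace ℝ (Fin d) → EuclideanSpace ℝ (Fin d)}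
    {μ : Measure (EuclideanSpace ℝ (Fin d))}
    (hw : AEStronglyMeasurable w μ) (hz : AEStronglyMeasurable z μ) :
    AEStronglyMeasurable (fun x => _root_.lineProj (w x) (z x)) μ := by
  have h1 : AEMeasurable (fun x => inner ℝ (z x) (w x) / ‖w x‖ ^ 2) μ :=
    (hz.inner hw).aemeasurable.div (hw.norm.aemeasurable.pow_const 2)
  exact h1.aestronglyMeasurable.smul hw

theorem ofReal_rpow_norm {F : Type*} [NormedAddCommGroup F] (y : F) {a : ℝ} (ha : 0 ≤ a) :
    ENNReal.ofReal (‖y‖ ^ a) = ‖y‖ₑ ^ a := by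
  rw [← ENNReal.ofReal_rpow_of_nonneg (norm_nonneg y) ha, ofReal_norm]

theorem lintegral_rpow_mul_ne_top (hΩ : IsOpen Ω) (hu : MemSobolev Ω p u) {c : ℝ} (hs : 1 < s)
    (hc : 0 ≤ c) (hm : 0 < m) (hq : 0 < q) (hw : AEStronglyMeasurable w (volume.restrict Ω))
    (hv : AEStronglyMeasurable v (volume.restrict Ω))
    (hsum : (s - 1 + c) / q + 1 / m = 1)
    (hwq : eLpNorm w (ENNReal.ofReal q) (volume.restrict Ω) ≠ ⊤)
    (hvq : eLpNorm v (ENNReal.ofReal q) (volume.restrict Ω) ≠ ⊤)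
    (hum : sobolevESeminorm Ω (ENNReal.ofReal m) u ≠ ⊤) :
    ∫⁻ x in Ω, ‖w x‖ₑ ^ (s - 1) * ‖v x‖ₑ ^ c * ‖frobeniusVec (weakGradient Ω u x)‖ₑ ≠ ⊤ := by
  have hs1 : 0 ≤ s - 1 := by linarith
  have h := lintegral_enorm_rpow_mul_le (b := 0) hw hw hv (hu.memLp_frobeniusVec hΩ).1
    hs1 le_rfl hc hq hm (by simpa using hsum)
  rw [← sobolevESeminorm_eq_eLpNorm] at h
  simp only [ENNReal.rpow_zero, mul_one] at h
  refine ne_top_of_le_ne_top ?_ h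
  exact ENNReal.mul_ne_top (ENNReal.mul_ne_top (ENNReal.rpow_ne_top_of_nonneg hs1 hwq)
    (ENNReal.rpow_ne_top_of_nonneg hc hvq)) hum

theorem integrableOn_of_abs_le {D : EuclideanSpace ℝ (Fin d) → ℝ} {T : EuclideanSpace ℝ (Fin d) → ℝ}
    {S : EuclideanSpace ℝ (Fin d) → ℝ≥0∞}
    (hD : AEStronglyMeasurable D (volume.restrict Ω)) (hκ : 0 ≤ κ)
    (hDT : ∀ᵐ x ∂(volume.restrict Ω), |D x| ≤ κ * T x)
    (hTS : ∀ x, ENNReal.ofReal (T x) = S x) (hS : ∫⁻ x in Ω, S x ≠ ⊤) : IntegrableOn D Ω := by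
  refine ⟨hD, ?_⟩
  have hle : ∫⁻ x in Ω, ‖D x‖ₑ ≤ ∫⁻ x in Ω, ENNReal.ofReal κ * S x := by
    refine lintegral_mono_ae ?_
    filter_upwards [hDT] with x hx
    rw [← hTS, ← ENNReal.ofReal_mul hκ, ← ofReal_norm, Real.norm_eq_abs]
    exact ENNReal.ofReal_le_ofReal hx
  rw [lintegral_const_mul' _ _ ENNReal.ofReal_ne_top] at hle
  exact hle.trans_lt (ENNReal.mul_ne_top ENNReal.ofReal_ne_top hS).lt_top

/-- Each integrand is dominated by `κ * ‖w‖ ^ (s - 1) * ‖z‖ * |∇y|` with `z` and `y` among `v` and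
`w`: degree `s` in `L^q` and one gradient in `L^m`. -/
theorem IsConvectionLaw.convIntegrable (hΩ : IsOpen Ω) (hs : 1 < s) (hκ : 0 ≤ κ)
    (hχ : IsConvectionLaw Ω s κ χ) (hm : 0 < m) (hq : 0 < q) (hsum : s / q + 1 / m = 1)
    (hw : MemSobolev Ω p w) (hv : MemSobolev Ω p v)
    (hwq : eLpNorm w (ENNReal.ofReal q) (volume.restrict Ω) ≠ ⊤)
    (hvq : eLpNorm v (ENNReal.ofReal q) (volume.restrict Ω) ≠ ⊤)
    (hwm : sobolevESeminorm Ω (ENNReal.ofReal m) w ≠ ⊤)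
    (hvm : sobolevESeminorm Ω (ENNReal.ofReal m) v ≠ ⊤) : ConvIntegrable Ω χ w v := by
  have hs1 : 0 ≤ s - 1 := by linarith
  have hχw := hχ.aestronglyMeasurable_comp hs hw.1.1
  have hgrad {y : EuclideanSpace ℝ (Fin d) → EuclideanSpace ℝ (Fin d)} (hy : MemSobolev Ω p y)
      (i j : Fin d) := (hy.memLp_weakGradient hΩ i j).1
  have hT (y z : EuclideanSpace ℝ (Fin d) → EuclideanSpace ℝ (Fin d))
      (x : EuclideanSpace ℝ (Fin d)) :
      ENNReal.ofReal (‖w x‖ ^ (s - 1) * ‖z x‖ * frobeniusNorm (weakGradient Ω y x)) =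
        ‖w x‖ₑ ^ (s - 1) * ‖z x‖ₑ ^ (1 : ℝ) * ‖frobeniusVec (weakGradient Ω y x)‖ₑ := by
    rw [← norm_frobeniusVec, ENNReal.ofReal_mul (by positivity),
      ENNReal.ofReal_mul (by positivity), ofReal_rpow_norm _ hs1, ofReal_norm, ofReal_norm,
      ENNReal.rpow_one]
  refine ⟨?_, ?_, ?_⟩
  · refine integrableOn_of_abs_le (AEStronglyMeasurable.advection hχw (hgrad hw) hv.1.1) hκ ?_
      (hT w v) (lintegral_rpow_mul_ne_top hΩ hw hs zero_le_one hm hq hw.1.1 hv.1.1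
        (by simpa using hsum) hwq hvq hwm)
    filter_upwards [hχ.zero, hχ.holder] with x h0 hx
    exact abs_advection_le_of_holder hs hκ h0 hx _ _ _
  · have hmeas : AEStronglyMeasurable (convIntegrand₂ Ω χ w v) (volume.restrict Ω) :=
      (AEStronglyMeasurable.advection hχw (hgrad hw)
        (AEStronglyMeasurable.lineProj hw.1.1 hv.1.1)).congr
        (Eventually.of_forall fun x => (inner_div_mul_advection _ _ _ _).symm)
    refine integrableOn_of_abs_le hmeas hκ ?_
      (hT w v) (lintegral_rpow_mul_ne_top hΩ hw hs zero_le_one hm hq hw.1.1 hv.1.1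
        (by simpa using hsum) hwq hvq hwm)
    filter_upwards [hχ.zero, hχ.holder] with x h0 hx
    rw [convIntegrand₂, inner_div_mul_advection]
    refine (abs_advection_le_of_holder hs hκ h0 hx _ _ _).trans ?_
    have := frobeniusNorm_nonneg (weakGradient Ω w x)
    gcongr
    exact norm_lineProj_le _ _
  · refine integrableOn_of_abs_le (AEStronglyMeasurable.advection hχw (hgrad hv) hw.1.1) hκ ?_
      (hT v w) (lintegral_rpow_mul_ne_top hΩ hv hs zero_le_one hm hq hw.1.1 hw.1.1
        (by simpa using hsum) hwq hwq hvm)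
    filter_upwards [hχ.zero, hχ.holder] with x h0 hx
    exact abs_advection_le_of_holder hs hκ h0 hx _ _ _

end ConvectiveIntegrals

/-! ### The estimate in terms of `W^{1,m}` seminorms. -/

section ConvectiveBound

variable {d : ℕ} {Ω : Set (EuclideanSpace ℝ (Fin d))} {s κ r m q : ℝ}
  {χ : EuclideanSpace ℝ (Fin d) → EuclideanSpace ℝ (Fin d) → EuclideanSpace ℝ (Fin d)}
  {u v w : EuclideanSpace ℝ (Fin d) → EuclideanSpace ℝ (Fin d)} {p : ℝ≥0∞}

theorem convective_eq_integral (hw : ConvIntegrable Ω χ w v) :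
    convective Ω s χ w v = ∫ x in Ω, (1 / s * convIntegrand₁ Ω χ w v x +
      (s - 2) / s * convIntegrand₂ Ω χ w v x - 1 / (s / (s - 1)) * convIntegrand₃ Ω χ w v x) := by
  obtain ⟨h1, h2, h3⟩ := hw
  rw [integral_sub (f := fun x => 1 / s * convIntegrand₁ Ω χ w v x +
      (s - 2) / s * convIntegrand₂ Ω χ w v x) ((h1.const_mul _).add (h2.const_mul _))
      (h3.const_mul _), integral_add (h1.const_mul _) (h2.const_mul _), integral_const_mul, integral_const_mul,
    integral_const_mul, convective]

theorem ConvIntegrable.integrableOn (hw : ConvIntegrable Ω χ w v) :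
    IntegrableOn (fun x => 1 / s * convIntegrand₁ Ω χ w v x +
      (s - 2) / s * convIntegrand₂ Ω χ w v x - 1 / (s / (s - 1)) * convIntegrand₃ Ω χ w v x) Ω :=
  ((hw.1.const_mul _).add (hw.2.1.const_mul _)).sub (hw.2.2.const_mul _)

theorem IsConvectionLaw.enorm_convective_sub_le_lintegral (hΩ : IsOpen Ω) (hs : 1 < s)
    (hκ : 0 ≤ κ) (hχ : IsConvectionLaw Ω s κ χ)
    (hu : MemSobolev Ω p u) (hv : MemSobolev Ω p v) (hw : MemSobolev Ω p w)
    (huv : ConvIntegrable Ω χ u v) (hwv : ConvIntegrable Ω χ w v) :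
    ‖convective Ω s χ u v - convective Ω s χ w v‖ₑ ≤ ENNReal.ofReal (6 * κ) *
      ((∫⁻ x in Ω, ‖‖u x‖ + ‖w x‖‖ₑ ^ (s - min s 2) * ‖(u - w) x‖ₑ ^ (min s 2 - 1) *
          ‖v x‖ₑ ^ (1 : ℝ) * ‖frobeniusVec (weakGradient Ω u x)‖ₑ) +
        (∫⁻ x in Ω, ‖‖u x‖ + ‖w x‖‖ₑ ^ (s - 1) * ‖(u - w) x‖ₑ ^ (0 : ℝ) *
          ‖v x‖ₑ ^ (1 : ℝ) * ‖frobeniusVec (weakGradient Ω (u - w) x)‖ₑ) +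
        ∫⁻ x in Ω, ‖‖u x‖ + ‖w x‖‖ₑ ^ (s + 1 - min s 2) * ‖(u - w) x‖ₑ ^ (min s 2 - 1) *
          ‖v x‖ₑ ^ (0 : ℝ) * ‖frobeniusVec (weakGradient Ω v x)‖ₑ) := by
  have ht1 : 0 ≤ min s 2 - 1 := sub_nonneg.2 (le_min hs.le one_le_two)
  have hts : 0 ≤ s - min s 2 := sub_nonneg.2 (min_le_left _ _)
  have hs1 : 0 ≤ s - 1 := by linarith
  have hts1 : 0 ≤ s + 1 - min s 2 := by linarith
  have hmN : AEMeasurable (fun x => ‖‖u x‖ + ‖w x‖‖ₑ) (volume.restrict Ω) :=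
    (hu.1.1.norm.add hw.1.1.norm).enorm
  have hme : AEMeasurable (fun x => ‖(u - w) x‖ₑ) (volume.restrict Ω) := (hu.1.1.sub hw.1.1).enorm
  have hmv : AEMeasurable (fun x => ‖v x‖ₑ) (volume.restrict Ω) := hv.1.1.enorm
  have hT (a b c : ℝ) {y : EuclideanSpace ℝ (Fin d) → EuclideanSpace ℝ (Fin d)}
      (hy : MemSobolev Ω p y) : AEMeasurable (fun x => ‖‖u x‖ + ‖w x‖‖ₑ ^ a *
        ‖(u - w) x‖ₑ ^ b * ‖v x‖ₑ ^ c * ‖frobeniusVec (weakGradient Ω y x)‖ₑ)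
        (volume.restrict Ω) :=
    (((hmN.pow_const _).mul (hme.pow_const _)).mul (hmv.pow_const _)).mul
      (hy.memLp_frobeniusVec hΩ).1.enorm
  rw [convective_eq_integral huv, convective_eq_integral hwv,
    ← integral_sub huv.integrableOn hwv.integrableOn]
  refine (enorm_integral_le_lintegral_enorm _).trans ?_
  rw [← lintegral_add_left' (hT _ _ _ hu), ← lintegral_add_right' _ (hT _ _ _ hv),
    ← lintegral_const_mul' _ _ ENNReal.ofReal_ne_top]
  refine lintegral_mono_ae ?_
  filter_upwards [hχ.zero, hχ.holder, hu.weakGradient_sub hΩ hw] with x h0 hx hgx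
  have key := abs_convective_integrand_sub_le hs hκ h0 hx (u x) (w x) (v x)
    (weakGradient Ω u x) (weakGradient Ω w x) (weakGradient Ω v x)
  have hN0 : 0 ≤ ‖u x‖ + ‖w x‖ := by positivity
  have hN (a : ℝ) (ha : 0 ≤ a) :
      ENNReal.ofReal ((‖u x‖ + ‖w x‖) ^ a) = ‖‖u x‖ + ‖w x‖‖ₑ ^ a := by
    rw [← ofReal_rpow_norm _ ha, Real.norm_of_nonneg hN0]
  have hA := frobeniusNorm_nonneg (weakGradient Ω u x)
  have hAB := frobeniusNorm_nonneg (weakGradient Ω u x - weakGradient Ω w x)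
  have hG := frobeniusNorm_nonneg (weakGradient Ω v x)
  rw [hgx, Pi.sub_apply, ← ofReal_norm, Real.norm_eq_abs]
  refine (ENNReal.ofReal_le_ofReal key).trans_eq ?_
  rw [ENNReal.ofReal_mul (by positivity), ENNReal.ofReal_add (by positivity) (by positivity),
    ENNReal.ofReal_add (by positivity) (by positivity),
    ENNReal.ofReal_mul (by positivity), ENNReal.ofReal_mul (by positivity),
    ENNReal.ofReal_mul (by positivity), ENNReal.ofReal_mul (by positivity),
    ENNReal.ofReal_mul (by positivity), ENNReal.ofReal_mul (by positivity),
    ENNReal.ofReal_mul (by positivity), ENNReal.ofReal_mul (by positivity), hN _ hts, hN _ hs1, hN _ hts1, ofReal_rpow_norm _ ht1,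
    ← norm_frobeniusVec, ← norm_frobeniusVec, ← norm_frobeniusVec, ofReal_norm, ofReal_norm,
    ofReal_norm, ofReal_norm]
  simp only [ENNReal.rpow_zero, ENNReal.rpow_one, mul_one, Pi.sub_apply]

/-- The three integrals have total degree `s` in the `L^q` factors, hence the common factor `C ^ s`.
The triangle inequality for the seminorm then brings them to one monomial (`B1`, `B2`; the third
already has that form), whence the factor `3`. -/
theorem IsConvectionLaw.enorm_convective_sub_le (hΩ : IsOpen Ω) (hs : 1 < s)
    (hκ : 0 ≤ κ) (hχ : IsConvectionLaw Ω s κ χ) (hm : 1 ≤ m) (hq : 1 ≤ q)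
    (hsum : s / q + 1 / m = 1)
    (hu : MemSobolev Ω p u) (hv : MemSobolev Ω p v) (hw : MemSobolev Ω p w)
    (huv : ConvIntegrable Ω χ u v) (hwv : ConvIntegrable Ω χ w v) {C : ℝ≥0∞}
    (hCu : eLpNorm u (ENNReal.ofReal q) (volume.restrict Ω) ≤
      C * sobolevESeminorm Ω (ENNReal.ofReal m) u)
    (hCv : eLpNorm v (ENNReal.ofReal q) (volume.restrict Ω) ≤
      C * sobolevESeminorm Ω (ENNReal.ofReal m) v)
    (hCw : eLpNorm w (ENNReal.ofReal q) (volume.restrict Ω) ≤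
      C * sobolevESeminorm Ω (ENNReal.ofReal m) w)
    (hCuw : eLpNorm (u - w) (ENNReal.ofReal q) (volume.restrict Ω) ≤
      C * sobolevESeminorm Ω (ENNReal.ofReal m) (u - w)) :
    ‖convective Ω s χ u v - convective Ω s χ w v‖ₑ ≤ ENNReal.ofReal (6 * κ) * (3 * (C ^ s *
      ((sobolevESeminorm Ω (ENNReal.ofReal m) u +
          sobolevESeminorm Ω (ENNReal.ofReal m) w) ^ (s + 1 - min s 2) *
        sobolevESeminorm Ω (ENNReal.ofReal m) (u - w) ^ (min s 2 - 1) *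
        sobolevESeminorm Ω (ENNReal.ofReal m) v))) := by
  have ht1 : 0 ≤ min s 2 - 1 := sub_nonneg.2 (le_min hs.le one_le_two)
  have ht2 : 0 ≤ 2 - min s 2 := sub_nonneg.2 (min_le_right _ _)
  have hts : 0 ≤ s - min s 2 := sub_nonneg.2 (min_le_left _ _)
  have hs1 : 0 ≤ s - 1 := by linarith
  have hts1 : 0 ≤ s + 1 - min s 2 := by linarith
  refine (hχ.enorm_convective_sub_le_lintegral hΩ hs hκ hu hv hw huv hwv).trans
    (mul_le_mul_right ?_ _)
  set X := sobolevESeminorm Ω (ENNReal.ofReal m) with hX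
  have hm1 : 1 ≤ ENNReal.ofReal m := by simpa using hm
  have hq1 : 1 ≤ ENNReal.ofReal q := by simpa using hq
  have hZ : X (u - w) ≤ X u + X w := by
    rw [hX, hu.sobolevESeminorm_sub_eq hΩ hw, sobolevESeminorm_eq_eLpNorm,
      sobolevESeminorm_eq_eLpNorm]
    exact eLpNorm_sub_le (hu.memLp_frobeniusVec hΩ).1 (hw.memLp_frobeniusVec hΩ).1 hm1
  have hN : eLpNorm (fun x => ‖u x‖ + ‖w x‖) (ENNReal.ofReal q) (volume.restrict Ω) ≤
      C * (X u + X w) := by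
    refine (eLpNorm_add_le hu.1.1.norm hw.1.1.norm hq1).trans ?_
    rw [eLpNorm_norm, eLpNorm_norm, mul_add]
    exact add_le_add hCu hCw
  have hmN : AEStronglyMeasurable (fun x => ‖u x‖ + ‖w x‖) (volume.restrict Ω) :=
    hu.1.1.norm.add hw.1.1.norm
  have hme : AEStronglyMeasurable (u - w) (volume.restrict Ω) := hu.1.1.sub hw.1.1
  have hq0 : 0 < q := by linarith
  have hm0 : 0 < m := by linarith
  have e1 : s - min s 2 + (min s 2 - 1) + 1 = s := by ring
  have e2 : s - 1 + 0 + 1 = s := by ring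
  have e3 : s + 1 - min s 2 + (min s 2 - 1) + 0 = s := by ring
  have T1 := lintegral_enorm_rpow_mul_le_of_eLpNorm_le hmN hme hv.1.1
    (hu.memLp_frobeniusVec hΩ).1 hts ht1 zero_le_one hq0 hm0 (by rw [e1]; exact hsum) hN hCuw hCv
  have T2 := lintegral_enorm_rpow_mul_le_of_eLpNorm_le hmN hme hv.1.1
    ((hu.sub hw).memLp_frobeniusVec hΩ).1 hs1 le_rfl zero_le_one hq0 hm0
    (by rw [e2]; exact hsum) hN hCuw hCv
  have T3 := lintegral_enorm_rpow_mul_le_of_eLpNorm_le hmN hme hv.1.1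
    (hv.memLp_frobeniusVec hΩ).1 hts1 ht1 le_rfl hq0 hm0 (by rw [e3]; exact hsum) hN hCuw hCv
  rw [← sobolevESeminorm_eq_eLpNorm, ENNReal.rpow_one] at T1 T2
  rw [← sobolevESeminorm_eq_eLpNorm] at T3
  rw [e1] at T1
  rw [e2] at T2
  rw [e3] at T3
  simp only [ENNReal.rpow_zero, mul_one] at T2 T3 ⊢
  have B1 : (X u + X w) ^ (s - min s 2) * X (u - w) ^ (min s 2 - 1) * X v * X u ≤
      (X u + X w) ^ (s + 1 - min s 2) * X (u - w) ^ (min s 2 - 1) * X v := by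
    rw [show s + 1 - min s 2 = s - min s 2 + 1 by ring,
      ENNReal.rpow_add_of_nonneg _ _ hts zero_le_one, ENNReal.rpow_one]
    calc _ ≤ (X u + X w) ^ (s - min s 2) * X (u - w) ^ (min s 2 - 1) * X v * (X u + X w) := by
          gcongr; exact le_self_add
      _ = _ := by ring
  have B2 : (X u + X w) ^ (s - 1) * X v * X (u - w) ≤
      (X u + X w) ^ (s + 1 - min s 2) * X (u - w) ^ (min s 2 - 1) * X v := by
    have hsplit : X (u - w) = X (u - w) ^ (2 - min s 2) * X (u - w) ^ (min s 2 - 1) := by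
      rw [← ENNReal.rpow_add_of_nonneg _ _ ht2 ht1]
      simp [show 2 - min s 2 + (min s 2 - 1) = 1 by ring]
    rw [show s + 1 - min s 2 = s - 1 + (2 - min s 2) by ring,
      ENNReal.rpow_add_of_nonneg _ _ hs1 ht2]
    calc _ = (X u + X w) ^ (s - 1) * X v *
            (X (u - w) ^ (2 - min s 2) * X (u - w) ^ (min s 2 - 1)) := by rw [← hsplit]
      _ ≤ (X u + X w) ^ (s - 1) * X v *
            ((X u + X w) ^ (2 - min s 2) * X (u - w) ^ (min s 2 - 1)) := by gcongr
      _ = _ := by ring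
  calc _ ≤ C ^ s * _ + C ^ s * _ + C ^ s * _ := add_le_add (add_le_add T1 T2) T3
    _ ≤ C ^ s * ((X u + X w) ^ (s + 1 - min s 2) * X (u - w) ^ (min s 2 - 1) * X v) +
        C ^ s * ((X u + X w) ^ (s + 1 - min s 2) * X (u - w) ^ (min s 2 - 1) * X v) +
        C ^ s * ((X u + X w) ^ (s + 1 - min s 2) * X (u - w) ^ (min s 2 - 1) * X v) := by
        gcongr
    _ = _ := by ring

end ConvectiveBound

/-! ### The condition `s ≤ m^*/m'` in real terms. -/

section Exponents

/-- For `m = 1` the quotient is `0`, which excludes `s > 0`. -/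
theorem one_lt_of_le_sobolevExponent_div {d : ℕ} {s m : ℝ} (hd : 1 < d) (hs : 0 < s) (hm : 1 ≤ m)
    (hsm : ENNReal.ofReal s ≤
      sobolevExponent d (ENNReal.ofReal m) / conjugateExponent (ENNReal.ofReal m)) : 1 < m := by
  refine lt_of_le_of_ne hm fun h => ?_
  subst h
  have h1 : (1 : ℝ≥0∞) < d := by exact_mod_cast hd
  have h2 : (d : ℝ≥0∞) / (d - 1) ≠ ⊤ :=
    ENNReal.div_ne_top (ENNReal.natCast_ne_top d) (tsub_pos_of_lt h1).ne'
  simp [sobolevExponent, conjugateExponent, h1, ENNReal.div_top] at hsm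
  linarith

/-- Here `m^*/m' = d (m - 1) / (d - m)`. The conclusion is `1/m - 1/d ≤ 1/q` for `q = s m'`, cleared
of denominators. -/
theorem mul_sub_le_of_le_sobolevExponent_div {d : ℕ} {s m : ℝ} (hm : 1 < m) (hmd : m < d)
    (hsm : ENNReal.ofReal s ≤
      sobolevExponent d (ENNReal.ofReal m) / conjugateExponent (ENNReal.ofReal m)) :
    s * (d - m) ≤ d * (m - 1) := by
  have hm0 : 0 < m := by linarith
  have h1 : ENNReal.ofReal m < d := by
    rw [← ENNReal.ofReal_natCast]
    exact (ENNReal.ofReal_lt_ofReal_iff (hm0.trans hmd)).2 hmd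
  have h2 : ENNReal.ofReal m ≠ 1 := by simpa using hm.ne'
  have hdm : 0 < (d : ℝ) - m := by linarith
  have hm1 : 0 < m - 1 := by linarith
  rw [sobolevExponent, conjugateExponent, if_pos h1, if_neg h2, if_neg ENNReal.ofReal_ne_top,
    ← ENNReal.ofReal_natCast, ← ENNReal.ofReal_one, ← ENNReal.ofReal_sub _ hm0.le,
    ← ENNReal.ofReal_sub _ zero_le_one, ← ENNReal.ofReal_mul (Nat.cast_nonneg d),
    ← ENNReal.ofReal_div_of_pos hdm, ← ENNReal.ofReal_div_of_pos hm1,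
    ← ENNReal.ofReal_div_of_pos (by positivity),
    ENNReal.ofReal_le_ofReal_iff (by positivity)] at hsm
  have e : (d : ℝ) * m / (d - m) / (m / (m - 1)) = d * (m - 1) / (d - m) := by
    field_simp
  rwa [e, le_div_iff₀ hdm] at hsm

end Exponents

/-! ### Passage from exponent `m` to exponent `r`. -/

section Seminorms

variable {d : ℕ} {Ω : Set (EuclideanSpace ℝ (Fin d))} {m r : ℝ}
  {u w : EuclideanSpace ℝ (Fin d) → EuclideanSpace ℝ (Fin d)}

theorem sobolevSeminorm_nonneg (Ω : Set (EuclideanSpace ℝ (Fin d))) (p : ℝ≥0∞)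
    (u : EuclideanSpace ℝ (Fin d) → EuclideanSpace ℝ (Fin d)) : 0 ≤ sobolevSeminorm Ω p u :=
  ENNReal.toReal_nonneg

theorem MemSobolev.sobolevESeminorm_ne_top_of_le (hΩ : IsOpen Ω) (hΩb : Bornology.IsBounded Ω)
    (hm : 0 < m) (hmr : m ≤ r) (hu : MemSobolev Ω (ENNReal.ofReal r) u) :
    sobolevESeminorm Ω (ENNReal.ofReal m) u ≠ ⊤ :=
  ne_top_of_le_ne_top (ENNReal.mul_ne_top (hu.sobolevESeminorm_ne_top hΩ)
    (rpow_volume_ne_top hΩb hm hmr))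
    (sobolevESeminorm_le_mul_of_le hΩ (ENNReal.ofReal_le_ofReal hmr) hu)

theorem exists_const_sobolevSeminorm_le (hΩ : IsOpen Ω) (hΩb : Bornology.IsBounded Ω)
    (hm : 0 < m) (hmr : m ≤ r) :
    ∃ K : ℝ, 0 ≤ K ∧ ∀ u : EuclideanSpace ℝ (Fin d) → EuclideanSpace ℝ (Fin d),
      MemSobolev Ω (ENNReal.ofReal r) u →
        sobolevSeminorm Ω (ENNReal.ofReal m) u ≤ K * sobolevSeminorm Ω (ENNReal.ofReal r) u := by
  have hK := rpow_volume_ne_top hΩb hm hmr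
  refine ⟨(volume Ω ^ (1 / (ENNReal.ofReal m).toReal - 1 / (ENNReal.ofReal r).toReal)).toReal,
    ENNReal.toReal_nonneg, fun u hu => ?_⟩
  rw [mul_comm, sobolevSeminorm, sobolevSeminorm, ← ENNReal.toReal_mul]
  exact ENNReal.toReal_mono (ENNReal.mul_ne_top (hu.sobolevESeminorm_ne_top hΩ) hK)
    (sobolevESeminorm_le_mul_of_le hΩ (ENNReal.ofReal_le_ofReal hmr) hu)

theorem Real.add_le_two_mul_rpow_add_rpow {a b r : ℝ} (ha : 0 ≤ a) (hb : 0 ≤ b) (hr : 0 < r) :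
    a + b ≤ 2 * (a ^ r + b ^ r) ^ (1 / r) := by
  have h {x : ℝ} (hx : 0 ≤ x) : x = (x ^ r) ^ (1 / r) := by
    rw [← Real.rpow_mul hx, mul_one_div_cancel hr.ne', Real.rpow_one]
  have h1 : a ≤ (a ^ r + b ^ r) ^ (1 / r) := by
    conv_lhs => rw [h ha]
    gcongr
    exact le_add_of_nonneg_right (by positivity)
  have h2 : b ≤ (a ^ r + b ^ r) ^ (1 / r) := by
    conv_lhs => rw [h hb]
    gcongr
    exact le_add_of_nonneg_left (by positivity)
  linarith

end Seminorms

/-! ### Choice of `q` and of the constant. -/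

theorem mainTheorem6 (d : ℕ) (hd : d = 2 ∨ d = 3)
    (Ω : Set (EuclideanSpace ℝ (Fin d))) (hΩ : IsOpen Ω) (hΩb : Bornology.IsBounded Ω)
    (r s m : ℝ) (hr : 1 < r) (hs : 1 < s) (hm : 1 ≤ m) (hmr : m ≤ r)
    (hsm : ENNReal.ofReal s ≤
      sobolevExponent d (ENNReal.ofReal m) / conjugateExponent (ENNReal.ofReal m)) :
    ∃ C : ℝ, 0 < C ∧
      ∀ (κ : ℝ)
        (χ : EuclideanSpace ℝ (Fin d) → EuclideanSpace ℝ (Fin d) → EuclideanSpace ℝ (Fin d)),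
        0 < κ → IsConvectionLaw Ω s κ χ →
        (∀ w v : EuclideanSpace ℝ (Fin d) → EuclideanSpace ℝ (Fin d),
          MemSobolevZero Ω (ENNReal.ofReal r) w → MemSobolevZero Ω (ENNReal.ofReal r) v →
          ConvIntegrable Ω χ w v) ∧
        (∀ u v w : EuclideanSpace ℝ (Fin d) → EuclideanSpace ℝ (Fin d),
          MemSobolevZero Ω (ENNReal.ofReal r) u → MemSobolevZero Ω (ENNReal.ofReal r) v →
          MemSobolevZero Ω (ENNReal.ofReal r) w →
          |convective Ω s χ u v - convective Ω s χ w v| ≤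
            C * κ *
              (sobolevSeminorm Ω (ENNReal.ofReal r) u ^ r
                + sobolevSeminorm Ω (ENNReal.ofReal r) w ^ r) ^ ((s + 1 - min s 2) / r) *
              sobolevSeminorm Ω (ENNReal.ofReal m) (u - w) ^ (min s 2 - 1) *
              sobolevSeminorm Ω (ENNReal.ofReal m) v) := by
  have hd1 : 1 < d := by omega
  have hm1 : 1 < m := one_lt_of_le_sobolevExponent_div hd1 (by linarith) hm hsm
  have hm0 : 0 < m := by linarith
  have hmm : 0 < m - 1 := by linarith
  have hs0 : 0 < s := by linarith
  -- This is `s m'`, the only exponent for which degree `s` in `L^q` pairs with a gradient in `L^m`.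
  obtain ⟨q, hq⟩ : ∃ q : ℝ, q = s * m / (m - 1) := ⟨_, rfl⟩
  have hq1 : 1 ≤ q := by
    rw [hq, one_le_div hmm]
    nlinarith
  have hq0 : 0 < q := by linarith
  have hsum : s / q + 1 / m = 1 := by
    rw [hq]; field_simp; ring
  have hmq : m < d → m⁻¹ - (d : ℝ)⁻¹ ≤ q⁻¹ := by
    intro hmd
    have h := mul_sub_le_of_le_sobolevExponent_div hm1 hmd hsm
    have hd0 : (0 : ℝ) < d := by linarith
    rw [hq, inv_div, inv_sub_inv hm0.ne' hd0.ne', div_le_div_iff₀ (by positivity) (by positivity)]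
    nlinarith
  have hr1 : 1 ≤ ENNReal.ofReal r := by simpa using hr.le
  have hσ : 0 ≤ s + 1 - min s 2 := by linarith [min_le_left s 2]
  have ht1 : 0 ≤ min s 2 - 1 := sub_nonneg.2 (le_min hs.le one_le_two)
  obtain ⟨C, hC, hsob⟩ := exists_const_eLpNorm_le_of_memSobolevZero hd1 hΩ hΩb hm hmr hq0 hmq
  obtain ⟨K, hK0, hK⟩ := exists_const_sobolevSeminorm_le hΩ hΩb hm0 hmr
  have hXt {y : EuclideanSpace ℝ (Fin d) → EuclideanSpace ℝ (Fin d)}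
      (hy : MemSobolevZero Ω (ENNReal.ofReal r) y) :
      sobolevESeminorm Ω (ENNReal.ofReal m) y ≠ ⊤ :=
    hy.1.sobolevESeminorm_ne_top_of_le hΩ hΩb hm0 hmr
  have hqt {y : EuclideanSpace ℝ (Fin d) → EuclideanSpace ℝ (Fin d)}
      (hy : MemSobolevZero Ω (ENNReal.ofReal r) y) :
      eLpNorm y (ENNReal.ofReal q) (volume.restrict Ω) ≠ ⊤ :=
    ne_top_of_le_ne_top (ENNReal.mul_ne_top hC (hXt hy)) (hsob y hy)
  -- `18 = 6 * 3` comes from the pointwise bound and the three terms, `C ^ s` from Sobolev, `2 * K`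
  -- from replacing exponent `m` by `r` in the sum of seminorms. The `+ 1` keeps the constant
  -- positive when `C` or `K` vanishes.
  refine ⟨18 * C.toReal ^ s * (2 * K) ^ (s + 1 - min s 2) + 1, by positivity,
    fun κ χ hκ hχ => ?_⟩
  have hint (w v : EuclideanSpace ℝ (Fin d) → EuclideanSpace ℝ (Fin d))
      (hw : MemSobolevZero Ω (ENNReal.ofReal r) w) (hv : MemSobolevZero Ω (ENNReal.ofReal r) v) :
      ConvIntegrable Ω χ w v :=
    hχ.convIntegrable hΩ hs hκ.le hm0 hq0 hsum hw.1 hv.1 (hqt hw) (hqt hv) (hXt hw) (hXt hv)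
  refine ⟨hint, fun u v w hu hv hw => ?_⟩
  have huw := hu.sub hΩ hr1 hw
  have key := hχ.enorm_convective_sub_le hΩ hs hκ.le hm hq1 hsum hu.1 hv.1 hw.1
    (hint u v hu hv) (hint w v hw hv) (hsob u hu) (hsob v hv) (hsob w hw) (hsob _ huw)
  have key2 := ENNReal.toReal_mono (ENNReal.mul_ne_top ENNReal.ofReal_ne_top
    (ENNReal.mul_ne_top (by simp) (ENNReal.mul_ne_top (ENNReal.rpow_ne_top_of_nonneg hs0.le hC)
      (ENNReal.mul_ne_top (ENNReal.mul_ne_top (ENNReal.rpow_ne_top_of_nonneg hσ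
        (ENNReal.add_ne_top.2 ⟨hXt hu, hXt hw⟩)) (ENNReal.rpow_ne_top_of_nonneg ht1 (hXt huw)))
        (hXt hv))))) key
  have hdef (y : EuclideanSpace ℝ (Fin d) → EuclideanSpace ℝ (Fin d)) :
      (sobolevESeminorm Ω (ENNReal.ofReal m) y).toReal = sobolevSeminorm Ω (ENNReal.ofReal m) y :=
    rfl
  simp only [ENNReal.toReal_mul, ← ENNReal.toReal_rpow, ENNReal.toReal_add (hXt hu) (hXt hw),
    toReal_enorm, Real.norm_eq_abs, ENNReal.toReal_ofReal (show 0 ≤ 6 * κ by positivity),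
    ENNReal.toReal_ofNat, hdef] at key2
  have hRu := sobolevSeminorm_nonneg Ω (ENNReal.ofReal r) u
  have hRw := sobolevSeminorm_nonneg Ω (ENNReal.ofReal r) w
  have hXu := sobolevSeminorm_nonneg Ω (ENNReal.ofReal m) u
  have hXw := sobolevSeminorm_nonneg Ω (ENNReal.ofReal m) w
  have hXuw := sobolevSeminorm_nonneg Ω (ENNReal.ofReal m) (u - w)
  have hXv := sobolevSeminorm_nonneg Ω (ENNReal.ofReal m) v
  have hY : (sobolevSeminorm Ω (ENNReal.ofReal m) u + sobolevSeminorm Ω (ENNReal.ofReal m) w) ^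
      (s + 1 - min s 2) ≤ (2 * K) ^ (s + 1 - min s 2) *
        (sobolevSeminorm Ω (ENNReal.ofReal r) u ^ r +
          sobolevSeminorm Ω (ENNReal.ofReal r) w ^ r) ^ ((s + 1 - min s 2) / r) := by
    calc _ ≤ (2 * K * (sobolevSeminorm Ω (ENNReal.ofReal r) u ^ r +
          sobolevSeminorm Ω (ENNReal.ofReal r) w ^ r) ^ (1 / r)) ^ (s + 1 - min s 2) := by
          gcongr
          have h1 := hK u hu.1
          have h2 := hK w hw.1
          have h3 := mul_le_mul_of_nonneg_left
            (Real.add_le_two_mul_rpow_add_rpow hRu hRw (by linarith : 0 < r)) hK0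
          linarith
      _ = _ := by
          rw [Real.mul_rpow (by positivity) (by positivity), ← Real.rpow_mul (by positivity)]
          congr 2
          ring
  have hR0 : 0 ≤ (sobolevSeminorm Ω (ENNReal.ofReal r) u ^ r +
    sobolevSeminorm Ω (ENNReal.ofReal r) w ^ r) ^ ((s + 1 - min s 2) / r) := by positivity
  have hZ0 : 0 ≤ sobolevSeminorm Ω (ENNReal.ofReal m) (u - w) ^ (min s 2 - 1) := by positivity
  have hL0 : 0 ≤ C.toReal ^ s := by positivity
  refine key2.trans ?_
  generalize (sobolevSeminorm Ω (ENNReal.ofReal r) u ^ r +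
    sobolevSeminorm Ω (ENNReal.ofReal r) w ^ r) ^ ((s + 1 - min s 2) / r) = R at hY hR0 ⊢
  generalize (sobolevSeminorm Ω (ENNReal.ofReal m) u +
    sobolevSeminorm Ω (ENNReal.ofReal m) w) ^ (s + 1 - min s 2) = Y at hY ⊢
  generalize sobolevSeminorm Ω (ENNReal.ofReal m) (u - w) ^ (min s 2 - 1) = Z at hZ0 ⊢
  generalize sobolevSeminorm Ω (ENNReal.ofReal m) v = V at hXv ⊢
  generalize C.toReal ^ s = L at hL0 ⊢
  generalize (2 * K) ^ (s + 1 - min s 2) = J at hY ⊢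
  calc 6 * κ * (3 * (L * (Y * Z * V))) ≤ 6 * κ * (3 * (L * (J * R * Z * V))) := by gcongr
    _ ≤ 6 * κ * (3 * (L * (J * R * Z * V))) + κ * R * Z * V :=
        le_add_of_nonneg_right (by positivity)
    _ = (18 * L * J + 1) * κ * R * Z * V := by ring
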